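/- Let $\beta\in\{1,2,4\}$ and let $\mathbb F_\beta$ be the real numbers, the complex numbers or the quaternions respectively. Let $n\ge N\ge 1$ be integers and let $M$ be an $n\times N$ random matrix whose columns $\mathbf m_1^n,\dots,\mathbf m_N^n\in(\mathbb F_\beta)^n$ are independent and identically distributed, each either (a) uniform on the unit ball $\|\mathbf m\|\le 1$, or (b) uniform on the unit sphere $\|\mathbf m\|=1$, or (c) Gaussian with density $\pi^{-\beta n/2}e^{-\|\mathbf m\|^2}$ with respect to Lebesgue measure on $(\mathbb F_\beta)^n\cong\mathbb R^{\beta n}$. Let $M_N$ denote the corresponding $N\times N$ random matrix (the case $n=N$), and write $\langle\cdot\rangle_{\|\mathbf m^n_k\|\le1}$, $\langle\cdot\rangle_{\|\mathbf m^n_k\|=1}$, $\langle\cdot\rangle_{{\rm G}^n}$ for the expectations in the three cases. Here $\det M^\dagger M$ is the product of the squares of the $N$ singular values of $M$ and $|\det M_N|$ is the product of the singular values of $M_N$; for $\beta=4$ a quaternion matrix is represented by $2\times2$ complex blocks, its singular values are then doubly degenerate, and each is counted once, so that these quantities are the square roots of the usual ones of the complex matrices. Put $\sigma_l=2\pi^{l/2}/\Gamma(l/2)$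 and $A_{\beta,n,N}=\prod_{i=1}^N\sigma_{\beta(n-i+1)}/\sigma_{\beta(N-i+1)}$. Then for every $h\in\mathbb C$, in each of the following lines the random variable on the left is integrable if and only if the one on the right is, and in that case \begin{align*} \big\langle(\det M^\dagger M)^{h/2}\big\rangle_{\|\mathbf m_k^n\|\le1}&=A_{\beta,n,N}\Big(\frac{n\,\sigma_{\beta N}}{N\,\sigma_{\beta n}}\Big)^N\big\langle|\det M_N|^{h+\beta(n-N)}\big\rangle_{\|\mathbf m_k^N\|\le1},\\ \big\langle(\det M^\dagger M)^{h/2}\big\rangle_{\|\mathbf m_k^n\|=1}&=A_{\beta,n,N}\Big(\frac{\sigma_{\beta N}}{\sigma_{\beta n}}\Big)^N\big\langle|\det M_N|^{h+\beta(n-N)}\big\rangle_{\|\mathbf m_k^N\|=1},\\ \big\langle(\det M^\dagger M)^{h/2}\big\rangle_{{\rm G}^n}&=A_{\beta,n,N}\Big(\frac1\pi\Big)^{\beta N(n-N)/2}\big\langle|\det M_N|^{h+\beta(n-N)}\big\rangle_{{\rm G}^N}. \end{align*} Moreover, if $\operatorname{Re}h>-\beta(n-N+1)$, then these random variables are integrable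 and, with $x=n+h/\beta$, \begin{align*} \big\langle(\det M^\dagger M)^{h/2}\big\rangle_{\|\mathbf m_k^n\|\le1}&=\prod_{i=1}^N\frac{\sigma_{\beta(n-i+1)}}{\sigma_{\beta(x-i+1)}}\Big(\frac{n\,\sigma_{\beta x}}{x\,\sigma_{\beta n}}\Big)^N,\\ \big\langle(\det M^\dagger M)^{h/2}\big\rangle_{\|\mathbf m_k^n\|=1}&=\prod_{i=1}^N\frac{\sigma_{\beta(n-i+1)}}{\sigma_{\beta(x-i+1)}}\Big(\frac{\sigma_{\beta x}}{\sigma_{\beta n}}\Big)^N,\\ \big\langle(\det M^\dagger M)^{h/2}\big\rangle_{{\rm G}^n}&=\prod_{i=1}^N\frac{\sigma_{\beta(n-i+1)}}{\sigma_{\beta(x-i+1)}}\;\pi^{Nh/2}. \end{align*} -/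

import Mathlib

open MeasureTheory
open scoped Matrix Quaternion

noncomputable section

namespace DetMoments

/-- The three cases of the Dyson index. -/
inductive DysonIndex where
  | real
  | complex
  | quaternion

/-- The numerical value `β = 1, 2, 4` of the Dyson index. -/
def DysonIndex.val : DysonIndex → ℕ
  | .real => 1
  | .complex => 2
  | .quaternion => 4

/-- The (skew) field `𝔽_β`: the reals, the complex numbers, Hamilton's quaternions. -/
def DysonField : DysonIndex → Type
  | .real => ℝ
  | .complex => ℂ
  | .quaternion => ℍ[ℝ]

instance instNormedAddCommGroupDysonField : (β : DysonIndex) → NormedAddCommGroup (DysonField β)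
  | .real => inferInstanceAs (NormedAddCommGroup ℝ)
  | .complex => inferInstanceAs (NormedAddCommGroup ℂ)
  | .quaternion => inferInstanceAs (NormedAddCommGroup ℍ[ℝ])

instance instInnerProductSpaceDysonField : (β : DysonIndex) → InnerProductSpace ℝ (DysonField β)
  | .real => inferInstanceAs (InnerProductSpace ℝ ℝ)
  | .complex => inferInstanceAs (InnerProductSpace ℝ ℂ)
  | .quaternion => inferInstanceAs (InnerProductSpace ℝ ℍ[ℝ])

instance instFiniteDimensionalDysonField : (β : DysonIndex) → FiniteDimensional ℝ (DysonField β)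
  | .real => inferInstanceAs (FiniteDimensional ℝ ℝ)
  | .complex => inferInstanceAs (FiniteDimensional ℝ ℂ)
  | .quaternion => inferInstanceAs (FiniteDimensional ℝ ℍ[ℝ])

instance instMeasurableSpaceDysonField (β : DysonIndex) : MeasurableSpace (DysonField β) :=
  borel (DysonField β)

instance instBorelSpaceDysonField (β : DysonIndex) : BorelSpace (DysonField β) := ⟨rfl⟩

instance instSecondCountableDysonField (β : DysonIndex) :
    SecondCountableTopology (DysonField β) :=
  have := FiniteDimensional.proper ℝ (DysonField β)
  inferInstance

/-- The space `(𝔽_β)ⁿ` with its Euclidean norm. Its `volume` is Lebesgue measure in the `β n` real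
coordinates of a vector. -/
abbrev ColVec (β : DysonIndex) (n : ℕ) : Type := PiLp 2 (fun _ : Fin n => DysonField β)

/-- The uniform distribution on the unit ball of `(𝔽_β)ⁿ`. -/
def ballLaw (β : DysonIndex) (n : ℕ) : Measure (ColVec β n) :=
  ProbabilityTheory.cond volume (Metric.closedBall 0 1)

/-- The uniform distribution on the unit sphere of `(𝔽_β)ⁿ`: normalised surface measure. -/
def sphereLaw (β : DysonIndex) (n : ℕ) : Measure (ColVec β n) :=
  ((volume : Measure (ColVec β n)).toSphere Set.univ)⁻¹ •
    ((volume : Measure (ColVec β n)).toSphere).map Subtype.val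

/-- The Gaussian distribution on `(𝔽_β)ⁿ`, with density `π ^ (-β n / 2) * exp (-‖v‖²)`. -/
def gaussLaw (β : DysonIndex) (n : ℕ) : Measure (ColVec β n) :=
  volume.withDensity fun v =>
    ENNReal.ofReal ((1 / Real.pi) ^ ((β.val : ℝ) * n / 2) * Real.exp (-‖v‖ ^ 2))

/-- The joint law of `N` independent columns, each with law `μ`. -/
def iidColumns {β : DysonIndex} {n : ℕ} (μ : Measure (ColVec β n)) (N : ℕ) :
    Measure (Fin N → ColVec β n) :=
  Measure.pi fun _ => μ

/-- The `n × N` matrix with the given columns. -/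
def ofColumns {β : DysonIndex} {n N : ℕ} (m : Fin N → ColVec β n) :
    Matrix (Fin n) (Fin N) (DysonField β) :=
  Matrix.of fun i k => m k i

/-- The `2 × 2` complex matrix `[z, w; -w̄, z̄]` of the quaternion `q = z + w j`. -/
def quatBlock (q : ℍ[ℝ]) : Matrix (Fin 2) (Fin 2) ℂ :=
  !![⟨q.re, q.imI⟩, ⟨q.imJ, q.imK⟩; -star ⟨q.imJ, q.imK⟩, star ⟨q.re, q.imI⟩]

/-- The `2n × 2N` complex matrix of an `n × N` quaternion matrix. -/
def quatMatrix {n N : ℕ} (M : Matrix (Fin n) (Fin N) ℍ[ℝ]) :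
    Matrix (Fin n × Fin 2) (Fin N × Fin 2) ℂ :=
  Matrix.of fun i k => quatBlock (M i.1 k.1) i.2 k.2

/-- `det M†M`, the product of the squares of the singular values of `M`. For quaternions the
eigenvalues of the complex matrix of `M†M` come in equal pairs and each pair is counted once, so
that the square root of its usual determinant is taken. -/
def gramDet : (β : DysonIndex) → {n N : ℕ} → Matrix (Fin n) (Fin N) (DysonField β) → ℝ
  | .real, _, _, (M : Matrix _ _ ℝ) => (Mᵀ * M).det
  | .complex, _, _, (M : Matrix _ _ ℂ) => (Mᴴ * M).det.re
  | .quaternion, _, _, M => √((quatMatrix M)ᴴ * quatMatrix M).det.re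

/-- `|det M|` of a square matrix, the product of its singular values, with the same convention
for quaternions. -/
def absDet : (β : DysonIndex) → {N : ℕ} → Matrix (Fin N) (Fin N) (DysonField β) → ℝ
  | .real, _, (M : Matrix _ _ ℝ) => |M.det|
  | .complex, _, (M : Matrix _ _ ℂ) => ‖M.det‖
  | .quaternion, _, M => √‖(quatMatrix M).det‖

/-- `(det M†M) ^ (h / 2)` for the matrix `M` with the given columns. -/
def gramPow {β : DysonIndex} {n N : ℕ} (h : ℂ) (m : Fin N → ColVec β n) : ℂ :=
  (gramDet β (ofColumns m) : ℂ) ^ (h / 2)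

/-- `|det M| ^ q` for the square matrix `M` with the given columns. -/
def absDetPow {β : DysonIndex} {N : ℕ} (q : ℂ) (m : Fin N → ColVec β N) : ℂ :=
  (absDet β (ofColumns m) : ℂ) ^ q

/-- `σ_l = 2 π ^ (l / 2) / Γ(l / 2)`, the area of the unit sphere in `ℝ^l`, for complex `l`. -/
def sphereArea (l : ℂ) : ℂ :=
  2 * (Real.pi : ℂ) ^ (l / 2) / Complex.Gamma (l / 2)

/-- `∏_{i=1}^N σ_{β(x-i+1)} / σ_{β(y-i+1)}`; at `x = n`, `y = N` this is `A_{β,n,N}`. -/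
def areaRatio (β : DysonIndex) (N : ℕ) (x y : ℂ) : ℂ :=
  ∏ i ∈ Finset.Icc 1 N,
    sphereArea ((β.val : ℂ) * (x - i + 1)) / sphereArea ((β.val : ℂ) * (y - i + 1))

end DetMoments

end

noncomputable section

namespace DetMoments

/-! The Gram determinant of the columns is the product of the squared distances from each column to
the right span of those adjoined before it. `BlockModel.det_gram_cons` proves one step of this by a
Schur complement, for all three fields at once through their complex block matrices, and
`gramDet_cons` takes the root that the quaternion convention requires.

Given the earlier columns, the new one is independent of them. In each of the three laws, the moment
of its distance to a subspace depends only on the dimension of the orthogonal complement, which is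
almost surely `β (n - j)` when `j` columns are already present. `HasProjMoments` isolates what is
needed of a law. Tonelli and Fubini then give, by induction on the number of columns, both the exact
integrability criterion (`HasProjMoments.integrable_gramPow_iff`) and the moment as a product over
`j < N` (`HasProjMoments.integral_gramPow`).

For a single vector, the Gaussian weight factors along a subspace and its complement, leaving a
radial Gamma integral. The norm of a projection is homogeneous, so in polar coordinates its integral
against any radial weight splits into a spherical and a radial factor (`integral_proj_radial`). The
Gaussian case therefore yields the sphere, and the sphere yields the ball.

`sphereArea_div` turns the Gamma quotients into ratios of sphere areas, which gives the closed
forms. The reduction to square matrices compares closed forms: replacing `n` by `N` and `h` by `h +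
β (n - N)` leaves `x` unchanged, and the area ratios telescope. Where the moments diverge, both
integrals are zero by convention. A single column on the sphere is special: its norm is 1, so every
moment exists. -/

/-! ### Gram determinants of block matrices. -/

/-- A representation by complex matrices of a real algebra with an inner product, whose
conjugation is at the same time the adjoint of multiplication and the conjugate transpose. -/
structure BlockModel (𝔸 : Type) [NormedAddCommGroup 𝔸] [InnerProductSpace ℝ 𝔸]
    (δ : Type) [Fintype δ] [DecidableEq δ] where
  rep : 𝔸 →ₗ[ℝ] Matrix δ δ ℂ
  mul : 𝔸 →ₗ[ℝ] 𝔸 →ₗ[ℝ] 𝔸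
  conj : 𝔸 → 𝔸
  rep_mul : ∀ a b, rep (mul a b) = rep a * rep b
  rep_conj : ∀ a, rep (conj a) = (rep a)ᴴ
  inner_mul : ∀ a b c, inner ℝ (mul a b) c = inner ℝ b (mul (conj a) c)
  rep_conj_mul_self : ∀ a, (rep a)ᴴ * rep a = ((‖a‖ ^ 2 : ℝ) : ℂ) • 1

namespace BlockModel

variable {𝔸 : Type} [NormedAddCommGroup 𝔸] [InnerProductSpace ℝ 𝔸]
  {δ : Type} [Fintype δ] [DecidableEq δ] (B : BlockModel 𝔸 δ)
  {ι κ : Type} [Fintype ι] [Fintype κ]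

/-- The block column of a vector over `𝔸`. -/
def blockCol (w : ι → 𝔸) : Matrix (ι × δ) δ ℂ :=
  Matrix.of fun i t => B.rep (w i.1) i.2 t

/-- The block matrix with the given columns over `𝔸`. -/
def blockMat (m : κ → PiLp 2 fun _ : ι => 𝔸) : Matrix (ι × δ) (κ × δ) ℂ :=
  Matrix.of fun i k => B.rep (m k.1 i.1) i.2 k.2

/-- The Gram matrix of the block matrix with the given columns. -/
def gram (m : κ → PiLp 2 fun _ : ι => 𝔸) : Matrix (κ × δ) (κ × δ) ℂ :=
  (B.blockMat m)ᴴ * B.blockMat m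

/-- The real linear map sending coefficients to the right linear combination of the columns. -/
def combine (m : κ → PiLp 2 fun _ : ι => 𝔸) : (κ → 𝔸) →ₗ[ℝ] PiLp 2 fun _ : ι => 𝔸 where
  toFun a := WithLp.toLp 2 fun i => ∑ k, B.mul (m k i) (a k)
  map_add' a b := by ext i; simp [Finset.sum_add_distrib]
  map_smul' c a := by ext i; simp [Finset.smul_sum]

/-- The right span of the columns, as a real subspace. -/
def colSpan (m : κ → PiLp 2 fun _ : ι => 𝔸) : Submodule ℝ (PiLp 2 fun _ : ι => 𝔸) :=
  LinearMap.range (B.combine m)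

omit [Fintype ι] in
lemma blockCol_combine (m : κ → PiLp 2 fun _ : ι => 𝔸) (a : κ → 𝔸) :
    B.blockCol (B.combine m a) = B.blockMat m * B.blockCol a := by
  ext ⟨i, s⟩ t
  simp [blockCol, blockMat, combine, Matrix.mul_apply, Fintype.sum_prod_type, B.rep_mul,
    Matrix.sum_apply]

omit [Fintype ι] in
lemma blockCol_add (v w : ι → 𝔸) : B.blockCol (v + w) = B.blockCol v + B.blockCol w := by
  ext i t
  simp [blockCol]

lemma rep_eq_zero [Nonempty δ] {a : 𝔸} (h : B.rep a = 0) : a = 0 := by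
  obtain ⟨s⟩ := ‹Nonempty δ›
  have := congrFun (congrFun (B.rep_conj_mul_self a) s) s
  simpa [h] using this.symm

/-- A vanishing combination `X a = 0` gives `Xᴴ X a = 0`, and the Gram matrix `Xᴴ X` is invertible.
-/
lemma combine_injective [Nonempty δ] [DecidableEq κ] {m : κ → PiLp 2 fun _ : ι => 𝔸}
    (hm : (B.gram m).det ≠ 0) : Function.Injective (B.combine m) := by
  rw [injective_iff_map_eq_zero]
  intro a ha
  have h1 : B.gram m * B.blockCol a = 0 := by
    rw [gram, Matrix.mul_assoc, ← blockCol_combine, ha]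
    have : B.blockCol (ι := ι) (0 : PiLp 2 fun _ : ι => 𝔸) = 0 := by ext; simp [blockCol]
    rw [this, Matrix.mul_zero]
  have h2 : B.blockCol a = 0 := by
    have := congrArg (fun Y => (B.gram m)⁻¹ * Y) h1
    simpa [← Matrix.mul_assoc, Matrix.nonsing_inv_mul _ (isUnit_iff_ne_zero.2 hm)] using this
  ext k
  refine B.rep_eq_zero ?_
  ext s t
  exact congrFun (congrFun h2 (k, s)) t

lemma finrank_colSpan [Nonempty δ] [DecidableEq κ] [FiniteDimensional ℝ 𝔸]
    {m : κ → PiLp 2 fun _ : ι => 𝔸}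
    (hm : (B.gram m).det ≠ 0) :
    Module.finrank ℝ (B.colSpan m) = Fintype.card κ * Module.finrank ℝ 𝔸 := by
  rw [colSpan, LinearMap.finrank_range_of_inj (B.combine_injective hm)]
  simp [Module.finrank_pi_fintype]

/-- Real orthogonality to a right span is already orthogonality over `𝔸`: the span contains every
right multiple `m k * b`, and moving `m k` across the inner product leaves `∑ i, conj (m k i) * z i`
orthogonal to every `b`. -/
lemma blockMat_mul_blockCol_of_mem_orthogonal [DecidableEq κ] {m : κ → PiLp 2 fun _ : ι => 𝔸}
    {z : PiLp 2 fun _ : ι => 𝔸} (hz : z ∈ (B.colSpan m)ᗮ) :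
    (B.blockMat m)ᴴ * B.blockCol z = 0 := by
  have key : ∀ k, ∑ i, B.mul (B.conj (m k i)) (z i) = 0 := by
    intro k
    refine ext_inner_left ℝ fun b => ?_
    have := (Submodule.mem_orthogonal _ _).1 hz (B.combine m (Pi.single k b))
      (LinearMap.mem_range_self _ _)
    rw [PiLp.inner_apply] at this
    rw [inner_zero_right, inner_sum, ← this]
    refine Finset.sum_congr rfl fun i _ => ?_
    rw [← B.inner_mul]
    congr 1
    simp only [combine, LinearMap.coe_mk, AddHom.coe_mk]
    rw [Finset.sum_eq_single k] <;> simp +contextual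
  ext ⟨k, s⟩ t
  have := congrFun (congrFun (congrArg B.rep (key k)) s) t
  simp only [map_sum, B.rep_mul, B.rep_conj, map_zero, Matrix.zero_apply, Matrix.sum_apply] at this
  rw [Matrix.zero_apply, ← this]
  simp [blockCol, blockMat, Matrix.mul_apply, Fintype.sum_prod_type]

lemma blockCol_conjTranspose_mul_self (z : PiLp 2 fun _ : ι => 𝔸) :
    (B.blockCol z)ᴴ * B.blockCol z = ((‖z‖ ^ 2 : ℝ) : ℂ) • 1 := by
  have : ∀ s t, ((B.blockCol z)ᴴ * B.blockCol z) s t = (∑ i, (B.rep (z i))ᴴ * B.rep (z i)) s t := by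
    intro s t
    simp [blockCol, Matrix.mul_apply, Fintype.sum_prod_type, Matrix.sum_apply]
  ext s t
  rw [this]
  simp only [B.rep_conj_mul_self, ← Finset.sum_smul, PiLp.norm_sq_eq_of_L2]
  push_cast
  rfl

/-- Adjoining a column multiplies the Gram determinant by a power of the norm of the component of
the new column orthogonal to the old ones. -/
theorem det_gram_cons [FiniteDimensional ℝ 𝔸] {N : ℕ} {m : Fin N → PiLp 2 fun _ : ι => 𝔸}
    (hm : (B.gram m).det ≠ 0) (w : PiLp 2 fun _ : ι => 𝔸) :
    (B.gram (Fin.cons w m : Fin (N + 1) → PiLp 2 fun _ : ι => 𝔸)).det =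
      (B.gram m).det * ((‖(B.colSpan m)ᗮ.starProjection w‖ ^ 2 : ℝ) : ℂ) ^ Fintype.card δ := by
  -- The new column has index 0; this reindexing moves it last, so that the Schur complement is
  -- taken with respect to the old Gram matrix.
  let e : (Fin N × δ) ⊕ δ ≃ Fin (N + 1) × δ := Equiv.ofBijective
    (Sum.elim (fun p => (p.1.succ, p.2)) fun t => (0, t)) (by
      constructor
      · rintro (⟨k, s⟩ | s) (⟨l, t⟩ | t) h <;> simp_all [Fin.succ_ne_zero, (Fin.succ_ne_zero _).symm]
      · rintro ⟨k, s⟩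
        refine Fin.cases ⟨Sum.inr s, rfl⟩ (fun l => ⟨Sum.inl (l, s), rfl⟩) k)
  obtain ⟨a, ha⟩ : (B.colSpan m).starProjection w ∈ B.colSpan m :=
    Submodule.starProjection_apply_mem _ _
  set z := (B.colSpan m)ᗮ.starProjection w with hz
  have hw : w = B.combine m a + z := by
    rw [ha, hz, Submodule.starProjection_add_starProjection_orthogonal]
  set X := B.blockMat m
  have hXZ : Xᴴ * B.blockCol z = 0 :=
    B.blockMat_mul_blockCol_of_mem_orthogonal (Submodule.starProjection_apply_mem _ _)
  have hY : B.blockCol w = X * B.blockCol a + B.blockCol z := by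
    rw [hw, ← blockCol_combine, ← blockCol_add]; rfl
  have hblocks : (B.gram (Fin.cons w m : Fin (N + 1) → PiLp 2 fun _ : ι => 𝔸)).submatrix e e =
      Matrix.fromBlocks (Xᴴ * X) (Xᴴ * B.blockCol w) ((B.blockCol w)ᴴ * X)
        ((B.blockCol w)ᴴ * B.blockCol w) := by
    have hl : ∀ k s, e (Sum.inl (k, s)) = (k.succ, s) := fun _ _ => rfl
    have hr : ∀ s, e (Sum.inr s) = (0, s) := fun _ => rfl
    ext (⟨k, s⟩ | s) (⟨l, t⟩ | t) <;>
      simp [gram, hl, hr, X, blockMat, blockCol, Matrix.mul_apply]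
  have hu : IsUnit (Xᴴ * X).det := isUnit_iff_ne_zero.2 hm
  let : Invertible (Xᴴ * X) := Matrix.invertibleOfIsUnitDet _ hu
  rw [← Matrix.det_submatrix_equiv_self e, hblocks, Matrix.det_fromBlocks₁₁]
  have h1 : Xᴴ * B.blockCol w = Xᴴ * X * B.blockCol a := by
    rw [hY, Matrix.mul_add, hXZ, add_zero, Matrix.mul_assoc]
  -- The part of `w` in the span cancels from the Schur complement; what remains is the Gram block
  -- of the orthogonal part `z`, a scalar matrix.
  have h2 : (B.blockCol w)ᴴ * B.blockCol w
      - (B.blockCol w)ᴴ * X * ⅟(Xᴴ * X) * (Xᴴ * B.blockCol w) =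
      (B.blockCol z)ᴴ * B.blockCol z := by
    rw [h1, Matrix.mul_assoc _ (⅟(Xᴴ * X)), ← Matrix.mul_assoc (⅟(Xᴴ * X)), invOf_mul_self,
      Matrix.one_mul, Matrix.mul_assoc, ← Matrix.mul_sub]
    conv_lhs => rw [hY]
    rw [add_sub_cancel_left, Matrix.conjTranspose_add, Matrix.add_mul, Matrix.conjTranspose_mul,
      Matrix.mul_assoc, hXZ, Matrix.mul_zero, zero_add]
  rw [h2, blockCol_conjTranspose_mul_self, Matrix.det_smul, Matrix.det_one, mul_one]
  rfl

end BlockModel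

/-! ### The three fields and their Gram determinants. -/

/-- The size of the complex matrices representing `𝔽_β`. -/
def DysonIndex.blockSize : DysonIndex → ℕ
  | .real => 1
  | .complex => 1
  | .quaternion => 2

/-- The real numbers as `1 × 1` complex matrices. -/
def realModel : BlockModel ℝ (Fin 1) where
  rep :=
    { toFun := fun a => Matrix.of fun _ _ => (a : ℂ)
      map_add' := fun a b => by ext; simp
      map_smul' := fun a b => by ext; simp }
  mul := LinearMap.mul ℝ ℝ
  conj := id
  rep_mul a b := by ext; simp [Matrix.mul_apply]
  rep_conj a := by ext; simp
  inner_mul a b c := by simp; ring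
  rep_conj_mul_self a := by
    ext s t
    simp [Matrix.mul_apply, Subsingleton.elim s t, sq]

/-- The complex numbers as `1 × 1` complex matrices. -/
def complexModel : BlockModel ℂ (Fin 1) where
  rep :=
    { toFun := fun a => Matrix.of fun _ _ => a
      map_add' := fun a b => by ext; simp
      map_smul' := fun a b => by ext; simp }
  mul := LinearMap.mul ℝ ℂ
  conj := star
  rep_mul a b := by ext; simp [Matrix.mul_apply]
  rep_conj a := by ext; simp
  inner_mul a b c := by simp [Complex.inner]; ring
  rep_conj_mul_self a := by
    ext s t
    simp [Matrix.mul_apply, Subsingleton.elim s t]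
    rw [mul_comm, Complex.mul_conj, Complex.normSq_eq_norm_sq]; simp

/-- The quaternions as `2 × 2` complex matrices. -/
def quaternionModel : BlockModel ℍ[ℝ] (Fin 2) where
  rep :=
    { toFun := quatBlock
      map_add' := fun a b => by
        ext s t; fin_cases s <;> fin_cases t <;> apply Complex.ext <;> simp [quatBlock] <;> ring
      map_smul' := fun a b => by
        ext s t; fin_cases s <;> fin_cases t <;> apply Complex.ext <;> simp [quatBlock] }
  mul := LinearMap.mul ℝ ℍ[ℝ]
  conj := star
  rep_mul a b := by
    ext s t
    fin_cases s <;> fin_cases t <;> apply Complex.ext <;>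
      simp [quatBlock, Matrix.mul_apply] <;> ring
  rep_conj a := by
    ext s t
    fin_cases s <;> fin_cases t <;> apply Complex.ext <;> simp [quatBlock]
  inner_mul a b c := by simp [Quaternion.inner_def]; ring
  rep_conj_mul_self a := by
    ext s t
    rw [sq, ← Quaternion.normSq_eq_norm_mul_self, Quaternion.normSq_def']
    fin_cases s <;> fin_cases t <;> apply Complex.ext <;>
      simp [quatBlock, Matrix.mul_apply, sq] <;> ring

/-- The model of `𝔽_β` by complex matrices. -/
def dysonModel : (β : DysonIndex) → BlockModel (DysonField β) (Fin β.blockSize)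
  | .real => realModel
  | .complex => complexModel
  | .quaternion => quaternionModel

lemma finrank_dysonField (β : DysonIndex) : Module.finrank ℝ (DysonField β) = β.val := by
  cases β
  · exact Module.finrank_self ℝ
  · exact Complex.finrank_real_complex
  · exact Quaternion.finrank_eq_four

lemma finrank_colVec (β : DysonIndex) (n : ℕ) : Module.finrank ℝ (ColVec β n) = β.val * n := by
  rw [(WithLp.linearEquiv 2 ℝ (Fin n → DysonField β)).finrank_eq]
  simp [Module.finrank_pi_fintype, finrank_dysonField, mul_comm]

open scoped ComplexOrder in
lemma det_gram_nonneg {β : DysonIndex} {n N : ℕ} (m : Fin N → ColVec β n) :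
    0 ≤ ((dysonModel β).gram m).det :=
  (Matrix.posSemidef_conjTranspose_mul_self _).det_nonneg

lemma det_gram_eq_re {β : DysonIndex} {n N : ℕ} (m : Fin N → ColVec β n) :
    ((dysonModel β).gram m).det = (((dysonModel β).gram m).det.re : ℂ) :=
  (Complex.ext rfl (Complex.nonneg_iff.1 (det_gram_nonneg m)).2.symm)

lemma det_gram_real {n N : ℕ} (m : Fin N → PiLp 2 fun _ : Fin n => ℝ) :
    (realModel.gram m).det =
      (((Matrix.of fun i k => m k i)ᵀ * Matrix.of fun i k => m k i).det : ℂ) := by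
  rw [← Complex.ofRealHom_eq_coe, RingHom.map_det,
    ← Matrix.det_submatrix_equiv_self (Equiv.prodUnique (Fin N) (Fin 1)).symm]
  congr 1
  ext k l
  simp [BlockModel.gram, BlockModel.blockMat, realModel, Matrix.mul_apply, Fintype.sum_prod_type]

lemma det_gram_complex {n N : ℕ} (m : Fin N → PiLp 2 fun _ : Fin n => ℂ) :
    (complexModel.gram m).det =
      ((Matrix.of fun i k => m k i)ᴴ * Matrix.of fun i k => m k i).det := by
  rw [← Matrix.det_submatrix_equiv_self (Equiv.prodUnique (Fin N) (Fin 1)).symm]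
  congr 1
  ext k l
  simp [BlockModel.gram, BlockModel.blockMat, complexModel, Matrix.mul_apply,
    Fintype.sum_prod_type]

/-- These two properties characterise `gramDet` uniformly in `β`, as the nonnegative root of the
complex block determinant, so identities can be checked after raising to the power `blockSize`. -/
lemma gramDet_nonneg_and_pow {β : DysonIndex} {n N : ℕ} (m : Fin N → ColVec β n) :
    0 ≤ gramDet β (ofColumns m) ∧
      gramDet β (ofColumns m) ^ β.blockSize = ((dysonModel β).gram m).det.re := by
  have h0 := (Complex.nonneg_iff.1 (det_gram_nonneg m)).1
  cases β
  · have : gramDet .real (ofColumns m) = ((dysonModel .real).gram m).det.re := by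
      have := congrArg Complex.re (det_gram_real m)
      exact this.symm
    rw [this]
    exact ⟨h0, pow_one _⟩
  · have : gramDet .complex (ofColumns m) = ((dysonModel .complex).gram m).det.re := by
      have := congrArg Complex.re (det_gram_complex m)
      exact this.symm
    rw [this]
    exact ⟨h0, pow_one _⟩
  · exact ⟨Real.sqrt_nonneg _, Real.sq_sqrt h0⟩

lemma gramDet_nonneg {β : DysonIndex} {n N : ℕ} (m : Fin N → ColVec β n) :
    0 ≤ gramDet β (ofColumns m) :=
  (gramDet_nonneg_and_pow m).1

lemma blockSize_ne_zero (β : DysonIndex) : β.blockSize ≠ 0 := by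
  cases β <;> simp [DysonIndex.blockSize]

lemma ofReal_gramDet_pow {β : DysonIndex} {n N : ℕ} (m : Fin N → ColVec β n) :
    ((gramDet β (ofColumns m) ^ β.blockSize : ℝ) : ℂ) = ((dysonModel β).gram m).det := by
  rw [(gramDet_nonneg_and_pow m).2, ← det_gram_eq_re]

/-- The right span over `𝔽_β` of the columns, as a real subspace. -/
def rightSpan {β : DysonIndex} {n N : ℕ} (m : Fin N → ColVec β n) : Submodule ℝ (ColVec β n) :=
  (dysonModel β).colSpan m

lemma det_gram_ne_zero {β : DysonIndex} {n N : ℕ} {m : Fin N → ColVec β n}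
    (hm : gramDet β (ofColumns m) ≠ 0) : ((dysonModel β).gram m).det ≠ 0 := by
  rw [← ofReal_gramDet_pow]
  exact_mod_cast pow_ne_zero _ hm

lemma finrank_rightSpan {β : DysonIndex} {n N : ℕ} {m : Fin N → ColVec β n}
    (hm : gramDet β (ofColumns m) ≠ 0) : Module.finrank ℝ (rightSpan m) = β.val * N := by
  have : Nonempty (Fin β.blockSize) := ⟨⟨0, Nat.pos_of_ne_zero (blockSize_ne_zero β)⟩⟩
  rw [rightSpan, BlockModel.finrank_colSpan _ (det_gram_ne_zero hm), Fintype.card_fin,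
    finrank_dysonField, mul_comm]

/-- Adjoining a column multiplies the Gram determinant by the squared distance from the new column
to the span of the old ones. -/
theorem gramDet_cons {β : DysonIndex} {n N : ℕ} {m : Fin N → ColVec β n}
    (hm : gramDet β (ofColumns m) ≠ 0) (w : ColVec β n) :
    gramDet β (ofColumns (Fin.cons w m : Fin (N + 1) → ColVec β n)) =
      gramDet β (ofColumns m) * ‖(rightSpan m)ᗮ.starProjection w‖ ^ 2 := by
  refine (pow_left_inj₀ (gramDet_nonneg _) (mul_nonneg (gramDet_nonneg _) (sq_nonneg _))
    (blockSize_ne_zero β)).1 ?_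
  have := (dysonModel β).det_gram_cons (det_gram_ne_zero hm) w
  rw [← ofReal_gramDet_pow, ← ofReal_gramDet_pow, Fintype.card_fin] at this
  rw [mul_pow]
  exact_mod_cast this

lemma gramDet_zero {β : DysonIndex} {n : ℕ} (m : Fin 0 → ColVec β n) :
    gramDet β (ofColumns m) = 1 := by
  refine (pow_left_inj₀ (gramDet_nonneg _) zero_le_one (blockSize_ne_zero β)).1 ?_
  rw [(gramDet_nonneg_and_pow m).2, Matrix.det_isEmpty]
  simp

lemma absDet_nonneg {β : DysonIndex} {N : ℕ} (M : Matrix (Fin N) (Fin N) (DysonField β)) :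
    0 ≤ absDet β M := by
  cases β
  · exact abs_nonneg _
  · exact norm_nonneg _
  · exact Real.sqrt_nonneg _

lemma gramDet_eq_absDet_sq {β : DysonIndex} {N : ℕ} (M : Matrix (Fin N) (Fin N) (DysonField β)) :
    gramDet β M = absDet β M ^ 2 := by
  have key : ∀ {κ : Type} [Fintype κ] [DecidableEq κ] (A : Matrix κ κ ℂ),
      (Aᴴ * A).det.re = ‖A.det‖ ^ 2 := by
    intro κ _ _ A
    rw [Matrix.det_mul, Matrix.det_conjTranspose, mul_comm, Complex.star_def, Complex.mul_conj,
      Complex.ofReal_re, Complex.normSq_eq_norm_sq]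
  cases β
  · have : ∀ A : Matrix (Fin N) (Fin N) ℝ, (Aᵀ * A).det = |A.det| ^ 2 := fun A => by
      rw [Matrix.det_mul, Matrix.det_transpose, sq_abs, sq]
    exact this M
  · exact key (κ := Fin N) M
  · change √_ = √_ ^ 2
    rw [key, Real.sqrt_sq (norm_nonneg _), Real.sq_sqrt (norm_nonneg _)]

/-- A positive real has argument 0, so no branch of the logarithm intervenes; at `t = 0` both powers
are 0, or both 1 when `q = 0`. -/
lemma ofReal_sq_cpow_half {t : ℝ} (ht : 0 ≤ t) (q : ℂ) :
    ((t ^ 2 : ℝ) : ℂ) ^ (q / 2) = (t : ℂ) ^ q := by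
  rcases ht.eq_or_lt with h | h
  · rw [← h]
    rcases eq_or_ne q 0 with rfl | hq
    · simp
    · simp [hq]
  · rw [Complex.ofReal_pow, ← Complex.cpow_nat_mul' (x := _) (n := 2)]
    · congr 1; push_cast; ring
    · simp [Complex.arg_ofReal_of_nonneg h.le, Real.pi_pos]
    · simp [Complex.arg_ofReal_of_nonneg h.le, Real.pi_pos.le]

lemma absDetPow_eq_gramPow {β : DysonIndex} {N : ℕ} (q : ℂ) :
    absDetPow (β := β) (N := N) q = gramPow q := by
  funext m
  rw [absDetPow, gramPow, gramDet_eq_absDet_sq, ofReal_sq_cpow_half (absDet_nonneg _)]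

lemma gramPow_cons {β : DysonIndex} {n N : ℕ} (h : ℂ) {m : Fin N → ColVec β n}
    (hm : gramDet β (ofColumns m) ≠ 0) (w : ColVec β n) :
    gramPow h (Fin.cons w m : Fin (N + 1) → ColVec β n) =
      gramPow h m * (‖(rightSpan m)ᗮ.starProjection w‖ : ℂ) ^ h := by
  rw [gramPow, gramDet_cons hm, Complex.ofReal_mul,
    Complex.mul_cpow_ofReal_nonneg (gramDet_nonneg _) (sq_nonneg _), gramPow,
    ofReal_sq_cpow_half (norm_nonneg _)]

lemma continuous_gramDet {β : DysonIndex} {n N : ℕ} :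
    Continuous fun m : Fin N → ColVec β n => gramDet β (ofColumns m) := by
  have h1 : ∀ s t, Continuous fun a => (dysonModel β).rep a s t := fun s t =>
    ((Matrix.entryLinearMap ℝ ℂ s t).comp (dysonModel β).rep).continuous_of_finiteDimensional
  have h2 : Continuous fun m : Fin N → ColVec β n => (dysonModel β).blockMat m :=
    continuous_matrix fun i k => (h1 _ _).comp (by fun_prop)
  have h3 : Continuous fun m : Fin N → ColVec β n => ((dysonModel β).gram m).det.re :=
    Complex.continuous_re.comp (h2.matrix_conjTranspose.matrix_mul h2).matrix_det
  have h4 : (fun m : Fin N → ColVec β n => gramDet β (ofColumns m)) =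
      fun m => ((dysonModel β).gram m).det.re ^ ((β.blockSize : ℝ)⁻¹) := by
    funext m
    rw [← (gramDet_nonneg_and_pow m).2, Real.pow_rpow_inv_natCast (gramDet_nonneg _)
      (blockSize_ne_zero β)]
  rw [h4]
  exact h3.rpow_const fun _ => Or.inr (by positivity)

lemma measurable_gramPow {β : DysonIndex} {n N : ℕ} (h : ℂ) :
    Measurable (gramPow (β := β) (n := n) (N := N) h) :=
  (Complex.measurable_ofReal.comp continuous_gramDet.measurable).pow_const _

/-! ### Gaussian and polar integrals of the norm of a projection. -/

section Radial

open Set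

/-- Almost every slice of the product is integrable, and some such slice has a nonzero constant
factor, which can be divided out. Without the nonvanishing assumptions the forward implication
fails. -/
lemma integrable_mul_prod_iff {α β : Type*} [MeasurableSpace α] [MeasurableSpace β]
    {μ : Measure α} {ν : Measure β} [SFinite μ] [SFinite ν] {f : α → ℂ} {g : β → ℂ}
    (hf : ¬ f =ᵐ[μ] 0) (hg : ¬ g =ᵐ[ν] 0) :
    Integrable (fun p : α × β => f p.1 * g p.2) (μ.prod ν) ↔ Integrable f μ ∧ Integrable g ν := by
  refine ⟨fun h => ⟨?_, ?_⟩, fun h => h.1.mul_prod h.2⟩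
  · obtain ⟨y, hy, hi⟩ := ((Filter.not_eventually.1 hg).and_eventually h.prod_left_ae).exists
    exact (integrable_mul_const_iff (isUnit_iff_ne_zero.2 hy) _).1 hi
  · obtain ⟨x, hx, hi⟩ := ((Filter.not_eventually.1 hf).and_eventually h.prod_right_ae).exists
    exact (integrable_const_mul_iff (isUnit_iff_ne_zero.2 hx) _).1 hi

/-- Divergence can only come from 0: on `(0, 1)` the factor `exp t` is bounded, and multiplying by
it leaves a pure power. -/
lemma integrableOn_Gamma_iff {s : ℂ} :
    IntegrableOn (fun t : ℝ => ((-t).exp : ℂ) * (t : ℂ) ^ (s - 1)) (Ioi 0) ↔ 0 < s.re := by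
  refine ⟨fun h => ?_, fun h => Complex.GammaIntegral_convergent h⟩
  have h1 : IntegrableOn (fun t : ℝ => (t : ℂ) ^ (s - 1)) (Ioo (0 : ℝ) 1) := by
    have h2 := (h.mono_set Ioo_subset_Ioi_self).bdd_mul (c := Real.exp 1)
      (f := fun t : ℝ => (t.exp : ℂ)) (by fun_prop) (by
        filter_upwards [ae_restrict_mem measurableSet_Ioo] with t ht
        rw [Complex.norm_real, Real.norm_eq_abs, Real.abs_exp]
        exact Real.exp_le_exp.2 ht.2.le)
    refine h2.congr (Filter.Eventually.of_forall fun t => ?_)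
    simp only
    rw [← mul_assoc, ← Complex.ofReal_mul, ← Real.exp_add, add_neg_cancel, Real.exp_zero,
      Complex.ofReal_one, one_mul]
  rw [intervalIntegral.integrableOn_Ioo_cpow_iff one_pos] at h1
  simpa using h1

lemma pow_smul_cpow {y : ℝ} (hy : 0 < y) {d : ℕ} (hd : d ≠ 0) (h : ℂ) :
    y ^ (d - 1) • (y : ℂ) ^ h = (y : ℂ) ^ ((d : ℂ) + h - 1) := by
  rw [Complex.real_smul, Complex.ofReal_pow, ← Complex.cpow_natCast,
    ← Complex.cpow_add _ _ (Complex.ofReal_ne_zero.2 hy.ne'), Nat.cast_pred (Nat.pos_of_ne_zero hd)]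
  ring_nf

/-- Prepares the substitution `t = y ^ 2` that turns the radial Gaussian integral into a Gamma
integral; `y ^ (2 - 1)` is its Jacobian up to the factor 2. -/
lemma gauss_radial_eq {y : ℝ} (hy : 0 < y) {d : ℕ} (hd : d ≠ 0) (h : ℂ) :
    y ^ (d - 1) • ((y : ℂ) ^ h * ((-y ^ 2).exp : ℂ)) =
      y ^ ((2 : ℝ) - 1) • (((-y ^ (2 : ℝ)).exp : ℂ) *
        ((y ^ (2 : ℝ) : ℝ) : ℂ) ^ (((d : ℂ) + h) / 2 - 1)) := by
  have h1 : ((y ^ 2 : ℝ) : ℂ) ^ (((d : ℂ) + h) / 2 - 1) = (y : ℂ) ^ ((d : ℂ) + h - 2) := by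
    rw [← ofReal_sq_cpow_half hy.le]; ring_nf
  rw [Real.rpow_two, h1, ← smul_mul_assoc, pow_smul_cpow hy hd, Complex.real_smul,
    Complex.ofReal_cpow hy.le, mul_left_comm,
    ← Complex.cpow_add _ _ (Complex.ofReal_ne_zero.2 hy.ne'), mul_comm]
  congr 2
  push_cast
  ring

variable {E : Type*} [NormedAddCommGroup E] [InnerProductSpace ℝ E] [FiniteDimensional ℝ E]
  [MeasurableSpace E] [BorelSpace E]

local notation "dim" => Module.finrank ℝ

lemma integrable_norm_cpow_mul_exp_iff [Nontrivial E] (h : ℂ) :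
    Integrable (fun v : E => (‖v‖ : ℂ) ^ h * ((-‖v‖ ^ 2).exp : ℂ)) ↔ -(dim E : ℝ) < h.re := by
  rw [integrable_fun_norm_addHaar volume
    (f := fun y : ℝ => (y : ℂ) ^ h * ((-y ^ 2).exp : ℂ)),
    integrableOn_congr_fun
      (fun y (hy : y ∈ Ioi 0) => gauss_radial_eq hy (Module.finrank_pos (R := ℝ) (M := E)).ne' h)
      measurableSet_Ioi,
    integrableOn_Ioi_comp_rpow_iff' (fun t : ℝ => ((-t).exp : ℂ) *
      (t : ℂ) ^ (((dim E : ℂ) + h) / 2 - 1)) two_ne_zero, integrableOn_Gamma_iff]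
  simp only [Complex.div_ofNat_re, Complex.add_re, Complex.natCast_re]
  constructor <;> intro h <;> linarith

lemma integral_exp_neg_norm_sq :
    ∫ v : E, ((-‖v‖ ^ 2).exp : ℂ) = (Real.pi : ℂ) ^ ((dim E : ℂ) / 2) := by
  have := GaussianFourier.integral_rexp_neg_mul_sq_norm (V := E) one_pos
  simp only [neg_mul, one_mul, div_one] at this
  rw [integral_complex_ofReal, this, Complex.ofReal_cpow Real.pi_pos.le]
  push_cast; rfl

lemma integrable_exp_neg_norm_sq : Integrable fun v : E => ((-‖v‖ ^ 2).exp : ℂ) := by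
  refine Integrable.of_integral_ne_zero ?_
  rw [integral_exp_neg_norm_sq]
  simp [Complex.cpow_eq_zero_iff, Real.pi_ne_zero]

lemma integral_norm_cpow_mul_exp_aux [Nontrivial E] {h : ℂ} (hh : -(dim E : ℝ) < h.re) :
    ∫ v : E, (‖v‖ : ℂ) ^ h * ((-‖v‖ ^ 2).exp : ℂ) =
      dim E • (volume : Measure E).real (Metric.ball 0 1) •
        (Complex.Gamma (((dim E : ℂ) + h) / 2) / 2) := by
  rw [integral_fun_norm_addHaar volume (fun y : ℝ => (y : ℂ) ^ h * ((-y ^ 2).exp : ℂ))]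
  congr 2
  rw [setIntegral_congr_fun measurableSet_Ioi
    (fun y (hy : y ∈ Ioi 0) => gauss_radial_eq hy (Module.finrank_pos (R := ℝ) (M := E)).ne' h)]
  have h1 := integral_comp_rpow_Ioi_of_pos (p := 2) (g := fun t : ℝ => ((-t).exp : ℂ) *
      (t : ℂ) ^ (((dim E : ℂ) + h) / 2 - 1)) two_pos
  rw [Complex.Gamma_eq_integral (by simp; linarith), Complex.GammaIntegral, ← h1]
  simp only [mul_smul]
  rw [integral_smul, Complex.real_smul]
  simp

lemma integral_norm_cpow_mul_exp [Nontrivial E] {h : ℂ} (hh : -(dim E : ℝ) < h.re) :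
    ∫ v : E, (‖v‖ : ℂ) ^ h * ((-‖v‖ ^ 2).exp : ℂ) =
      (Real.pi : ℂ) ^ ((dim E : ℂ) / 2) *
        (Complex.Gamma (((dim E : ℂ) + h) / 2) / Complex.Gamma ((dim E : ℂ) / 2)) := by
  have hpos : (0 : ℝ) < dim E := Nat.cast_pos.2 Module.finrank_pos
  -- The case `h = 0` is the known Gaussian integral; dividing by it eliminates the volume of the
  -- ball.
  have h0 := integral_norm_cpow_mul_exp_aux (E := E) (h := 0) (by simpa using hpos)
  simp only [Complex.cpow_zero, one_mul, add_zero] at h0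
  rw [integral_exp_neg_norm_sq] at h0
  have hG : Complex.Gamma ((dim E : ℂ) / 2) ≠ 0 :=
    Complex.Gamma_ne_zero_of_re_pos (by simpa using Module.finrank_pos)
  rw [integral_norm_cpow_mul_exp_aux hh, h0]
  simp only [nsmul_eq_mul, Complex.real_smul]
  field_simp

omit [MeasurableSpace E] [BorelSpace E] in
lemma norm_starProjection_smul (W : Submodule ℝ E) {r : ℝ} (hr : 0 ≤ r) (u : E) (h : ℂ) :
    (‖W.starProjection (r • u)‖ : ℂ) ^ h = (‖W.starProjection u‖ : ℂ) ^ h * (r : ℂ) ^ h := by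
  rw [map_smul, norm_smul, Real.norm_of_nonneg hr, Complex.ofReal_mul,
    Complex.mul_cpow_ofReal_nonneg hr (norm_nonneg _), mul_comm]

/-- The splitting of a Euclidean space along a subspace, as a measurable equivalence. -/
def splitEquiv (W : Submodule ℝ E) : E ≃ᵐ W × Wᗮ :=
  W.orthogonalDecomposition.toHomeomorph.toMeasurableEquiv.trans (MeasurableEquiv.toLp 2 _).symm

lemma measurePreserving_splitEquiv (W : Submodule ℝ E) : MeasurePreserving (splitEquiv W) :=
  W.orthogonalDecomposition.measurePreserving.trans (WithLp.volume_preserving_ofLp _ _)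

lemma norm_splitEquiv_fst (W : Submodule ℝ E) (v : E) :
    ‖(splitEquiv W v).1‖ = ‖W.starProjection v‖ := by
  rfl

lemma norm_splitEquiv_sq (W : Submodule ℝ E) (v : E) :
    ‖v‖ ^ 2 = ‖(splitEquiv W v).1‖ ^ 2 + ‖(splitEquiv W v).2‖ ^ 2 := by
  rw [← W.orthogonalDecomposition.norm_map v, WithLp.prod_norm_sq_eq_of_L2]
  rfl

lemma proj_gauss_eq (W : Submodule ℝ E) (h : ℂ) :
    (fun v : E => (‖W.starProjection v‖ : ℂ) ^ h * ((-‖v‖ ^ 2).exp : ℂ)) =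
      (fun p : W × Wᗮ => ((‖p.1‖ : ℂ) ^ h * ((-‖p.1‖ ^ 2).exp : ℂ)) * ((-‖p.2‖ ^ 2).exp : ℂ)) ∘
        splitEquiv W := by
  funext v
  simp only [Function.comp_apply]
  rw [norm_splitEquiv_sq W v, norm_splitEquiv_fst, neg_add, Real.exp_add]
  push_cast
  ring

lemma ae_norm_ne_zero [Nontrivial E] : ∀ᵐ v : E, ‖v‖ ≠ 0 := by
  filter_upwards [measure_singleton (μ := (volume : Measure E)) 0 |> compl_mem_ae_iff.2] with v hv
  simpa using hv

lemma integrable_proj_gauss_iff (W : Submodule ℝ E) [Nontrivial W] (h : ℂ) :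
    Integrable (fun v : E => (‖W.starProjection v‖ : ℂ) ^ h * ((-‖v‖ ^ 2).exp : ℂ)) ↔
      -(dim W : ℝ) < h.re := by
  rw [proj_gauss_eq, (measurePreserving_splitEquiv W).integrable_comp_emb
    (splitEquiv W).measurableEmbedding, ← integrable_norm_cpow_mul_exp_iff (E := W)]
  refine (integrable_mul_prod_iff (f := fun w : W => (‖w‖ : ℂ) ^ h * ((-‖w‖ ^ 2).exp : ℂ))
    (g := fun w : Wᗮ => ((-‖w‖ ^ 2).exp : ℂ)) ?_ ?_).trans
      ⟨And.left, fun h => ⟨h, integrable_exp_neg_norm_sq⟩⟩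
  · intro h0
    obtain ⟨v, hv, hv'⟩ := (h0.and ae_norm_ne_zero).exists
    simp [Complex.cpow_eq_zero_iff] at hv hv'
    exact hv' hv.1
  · intro h0
    obtain ⟨v, hv⟩ := h0.exists
    simp at hv

lemma integral_proj_gauss (W : Submodule ℝ E) [Nontrivial W] {h : ℂ} (hh : -(dim W : ℝ) < h.re) :
    ∫ v : E, (‖W.starProjection v‖ : ℂ) ^ h * ((-‖v‖ ^ 2).exp : ℂ) =
      (Real.pi : ℂ) ^ ((dim E : ℂ) / 2) *
        (Complex.Gamma (((dim W : ℂ) + h) / 2) / Complex.Gamma ((dim W : ℂ) / 2)) := by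
  rw [proj_gauss_eq]
  have := (measurePreserving_splitEquiv W).integral_comp (splitEquiv W).measurableEmbedding
    (fun p : W × Wᗮ => ((‖p.1‖ : ℂ) ^ h * ((-‖p.1‖ ^ 2).exp : ℂ)) * ((-‖p.2‖ ^ 2).exp : ℂ))
  simp only [Function.comp_def]
  rw [this, Measure.volume_eq_prod]
  rw [integral_prod_mul (fun w : W => (‖w‖ : ℂ) ^ h * ((-‖w‖ ^ 2).exp : ℂ))
    (fun w : Wᗮ => ((-‖w‖ ^ 2).exp : ℂ)), integral_norm_cpow_mul_exp hh,
    integral_exp_neg_norm_sq, mul_right_comm,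
    ← Complex.cpow_add _ _ (Complex.ofReal_ne_zero.2 Real.pi_ne_zero), ← add_div]
  congr 3
  exact_mod_cast W.finrank_add_finrank_orthogonal

lemma integrable_polar_iff [Nontrivial E] {φ : E → ℂ} :
    Integrable φ ↔ Integrable
      (fun p : Metric.sphere (0 : E) 1 × Ioi (0 : ℝ) => φ (p.2.1 • p.1.1))
      ((volume : Measure E).toSphere.prod (Measure.volumeIoiPow (dim E - 1))) := by
  have h := (volume : Measure E).measurePreserving_homeomorphUnitSphereProd.integrable_comp_emb
    (g := fun p => φ (p.2.1 • p.1.1)) (Homeomorph.measurableEmbedding _)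
  rw [← h]
  have h2 : (fun p : Metric.sphere (0 : E) 1 × Ioi (0 : ℝ) => φ (p.2.1 • p.1.1)) ∘
      homeomorphUnitSphereProd E = φ ∘ ((↑) : ({0}ᶜ : Set E) → E) := by
    funext x
    have := congrArg Subtype.val ((homeomorphUnitSphereProd E).symm_apply_apply x)
    exact congrArg φ this
  rw [h2, ← integrableOn_iff_comap_subtypeVal (measurableSet_singleton _).compl, IntegrableOn,
    restrict_compl_singleton]

lemma integral_polar [Nontrivial E] (φ : E → ℂ) :
    ∫ v, φ v = ∫ p : Metric.sphere (0 : E) 1 × Ioi (0 : ℝ), φ (p.2.1 • p.1.1)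
      ∂((volume : Measure E).toSphere.prod (Measure.volumeIoiPow (dim E - 1))) := by
  rw [← (volume : Measure E).measurePreserving_homeomorphUnitSphereProd.integral_comp
    (Homeomorph.measurableEmbedding _) (fun p => φ (p.2.1 • p.1.1))]
  have h2 : ∀ x, φ ((homeomorphUnitSphereProd E x).2.1 • (homeomorphUnitSphereProd E x).1.1) =
      φ x.1 := by
    intro x
    have := congrArg Subtype.val ((homeomorphUnitSphereProd E).symm_apply_apply x)
    exact congrArg φ this
  simp only [h2]
  rw [integral_subtype_comap (measurableSet_singleton _).compl φ, restrict_compl_singleton]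

/-- The spherical measure of a set is a multiple of the volume of the cone over it, and here that
cone stays inside the null set `V`. -/
lemma toSphere_submodule_eq_zero [Nontrivial E] {V : Submodule ℝ E} (hV : V ≠ ⊤) :
    (volume : Measure E).toSphere {u | u.1 ∈ V} = 0 := by
  have hm : MeasurableSet {u : Metric.sphere (0 : E) 1 | u.1 ∈ V} :=
    measurable_subtype_coe V.closed_of_finiteDimensional.measurableSet
  rw [Measure.toSphere_apply' _ hm, measure_mono_null ?_ (Measure.addHaar_submodule volume V hV),
    mul_zero]
  rintro _ ⟨r, -, _, ⟨u, hu, rfl⟩, rfl⟩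
  exact V.smul_mem r hu

omit [MeasurableSpace E] [BorelSpace E] in
lemma starProjection_eq_zero_iff_mem (W : Submodule ℝ E) (v : E) :
    W.starProjection v = 0 ↔ v ∈ Wᗮ :=
  Submodule.starProjection_apply_eq_zero_iff _

omit [FiniteDimensional ℝ E] [MeasurableSpace E] [BorelSpace E] in
lemma orthogonal_ne_top (W : Submodule ℝ E) [Nontrivial W] : Wᗮ ≠ ⊤ := by
  rw [Ne, Submodule.orthogonal_eq_top_iff]
  exact (Submodule.nontrivial_iff_ne_bot).1 ‹_›

lemma ae_toSphere_starProjection_ne_zero [Nontrivial E] (W : Submodule ℝ E) [Nontrivial W] :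
    ∀ᵐ u ∂(volume : Measure E).toSphere, W.starProjection u.1 ≠ 0 := by
  filter_upwards [compl_mem_ae_iff.2 (toSphere_submodule_eq_zero (orthogonal_ne_top W))] with u hu
  rwa [Ne, starProjection_eq_zero_iff_mem]

section Polar

variable [Nontrivial E] (W : Submodule ℝ E) [Nontrivial W] {h : ℂ} {ψ : ℝ → ℂ}

/-- The profile is only required not to vanish on `(0, 1)`, so that the indicator for the ball
qualifies as well as the Gaussian. -/
lemma radial_ne_zero (hψ : ∀ r ∈ Ioo (0 : ℝ) 1, ψ r ≠ 0) (n : ℕ) :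
    ¬ (fun r : Ioi (0 : ℝ) => (r.1 : ℂ) ^ h * ψ r.1) =ᵐ[Measure.volumeIoiPow n] 0 := by
  intro h0
  have h1 : Measure.volumeIoiPow n (Iio (⟨1, mem_Ioi.2 one_pos⟩ : Ioi (0 : ℝ))) = 0 := by
    refine measure_mono_null (fun r hr => Set.mem_compl fun hr' => ?_) h0
    change (r.1 : ℂ) ^ h * ψ r.1 = 0 at hr'
    have hr0 : (r.1 : ℂ) ≠ 0 := Complex.ofReal_ne_zero.2 (ne_of_gt r.2)
    simp only [mul_eq_zero, Complex.cpow_eq_zero_iff, hr0, false_and,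
      false_or] at hr'
    exact hψ r.1 ⟨r.2, hr⟩ hr'
  rw [Measure.volumeIoiPow_apply_Iio] at h1
  simp at h1
  norm_cast at h1

/-- By homogeneity the integrand at `r • u` is a function of `u` times a function of `r`, and polar
coordinates make the volume a product measure. -/
lemma integrable_proj_radial_iff (hψ : ∀ r ∈ Ioo (0 : ℝ) 1, ψ r ≠ 0) :
    Integrable (fun v : E => (‖W.starProjection v‖ : ℂ) ^ h * ψ ‖v‖) ↔
      Integrable (fun u => (‖W.starProjection u.1‖ : ℂ) ^ h) (volume : Measure E).toSphere ∧
      Integrable (fun r : Ioi (0 : ℝ) => (r.1 : ℂ) ^ h * ψ r.1)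
        (Measure.volumeIoiPow (dim E - 1)) := by
  rw [integrable_polar_iff, ← integrable_mul_prod_iff ?_ (radial_ne_zero hψ _)]
  · refine integrable_congr (Filter.Eventually.of_forall fun p => ?_)
    have hp : ‖(p.2.1 • p.1.1 : E)‖ = p.2.1 := by
      rw [norm_smul, Real.norm_of_nonneg (le_of_lt p.2.2), norm_eq_of_mem_sphere, mul_one]
    simp only [norm_starProjection_smul W (le_of_lt p.2.2), hp, mul_assoc]
  · intro h0
    have : NeZero (volume : Measure E).toSphere := ⟨by simp⟩
    obtain ⟨u, hu, hu'⟩ := (h0.and (ae_toSphere_starProjection_ne_zero W)).exists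
    simp [Complex.cpow_eq_zero_iff] at hu
    simp [hu.1] at hu'

omit [Nontrivial W] in
lemma integral_proj_radial (h : ℂ) (ψ : ℝ → ℂ) :
    ∫ v : E, (‖W.starProjection v‖ : ℂ) ^ h * ψ ‖v‖ =
      (∫ u, (‖W.starProjection u.1‖ : ℂ) ^ h ∂(volume : Measure E).toSphere) *
      ∫ r : Ioi (0 : ℝ), (r.1 : ℂ) ^ h * ψ r.1 ∂(Measure.volumeIoiPow (dim E - 1)) := by
  rw [integral_polar, ← integral_prod_mul]
  refine integral_congr_ae (Filter.Eventually.of_forall fun p => ?_)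
  have hp : ‖(p.2.1 • p.1.1 : E)‖ = p.2.1 := by
    rw [norm_smul, Real.norm_of_nonneg (le_of_lt p.2.2), norm_eq_of_mem_sphere, mul_one]
  simp only [norm_starProjection_smul W (le_of_lt p.2.2), hp, mul_assoc]

lemma integrable_norm_radial_iff (hψ : ∀ r ∈ Ioo (0 : ℝ) 1, ψ r ≠ 0) :
    Integrable (fun v : E => (‖v‖ : ℂ) ^ h * ψ ‖v‖) ↔
      Integrable (fun r : Ioi (0 : ℝ) => (r.1 : ℂ) ^ h * ψ r.1)
        (Measure.volumeIoiPow (dim E - 1)) := by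
  have : Nontrivial (⊤ : Submodule ℝ E) := (Submodule.nontrivial_iff_ne_bot).2 top_ne_bot
  have := integrable_proj_radial_iff (⊤ : Submodule ℝ E) (h := h) hψ
  simpa [Submodule.starProjection_top] using this

lemma integral_norm_radial (h : ℂ) (ψ : ℝ → ℂ) :
    ∫ v : E, (‖v‖ : ℂ) ^ h * ψ ‖v‖ = ((volume : Measure E).toSphere.real univ : ℂ) *
      ∫ r : Ioi (0 : ℝ), (r.1 : ℂ) ^ h * ψ r.1 ∂(Measure.volumeIoiPow (dim E - 1)) := by
  have := integral_proj_radial (⊤ : Submodule ℝ E) h ψ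
  simpa [Submodule.starProjection_top] using this

end Polar

end Radial

open Set in
lemma indicator_ball_eq {E : Type*} [SeminormedAddCommGroup E] (f : E → ℂ) :
    (fun v : E => f v * (Iio (1 : ℝ)).indicator 1 ‖v‖) = (Metric.ball 0 1).indicator f := by
  funext v
  by_cases hv : ‖v‖ < 1 <;> simp [indicator, hv]

/-! ### Moments of projections on the sphere and the ball. -/

section Vector

open Set

variable {E : Type*} [NormedAddCommGroup E] [InnerProductSpace ℝ E] [FiniteDimensional ℝ E]
  [MeasurableSpace E] [BorelSpace E]

local notation "dim" => Module.finrank ℝ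

/-- The moment of order `h` of the norm of a Gaussian vector in dimension `d`. -/
def gammaMoment (d : ℕ) (h : ℂ) : ℂ :=
  Complex.Gamma (((d : ℂ) + h) / 2) / Complex.Gamma ((d : ℂ) / 2)

lemma gammaMoment_ne_zero {d : ℕ} (hd : 0 < d) {h : ℂ} (hh : -(d : ℝ) < h.re) :
    gammaMoment d h ≠ 0 := by
  refine div_ne_zero ?_ ?_ <;> refine Complex.Gamma_ne_zero_of_re_pos ?_
  · simp; linarith
  · simpa using hd

lemma measurable_norm_starProjection_cpow (W : Submodule ℝ E) (h : ℂ) :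
    Measurable fun v : E => (‖W.starProjection v‖ : ℂ) ^ h :=
  (Complex.measurable_ofReal.comp W.starProjection.continuous.norm.measurable).pow_const _

variable [Nontrivial E]

/-- In full dimension the projected norm is constantly 1. Otherwise the Gaussian criterion cannot be
quoted directly for very negative `h.re`, since its radial factor may diverge too. Projected norms
on the sphere are at most 1, so integrability would pass to the critical exponent `-dim W`; there
the radial factor converges because `dim W < dim E`, contradicting the strict Gaussian bound. -/
lemma integrable_norm_sphere_iff (W : Submodule ℝ E) [Nontrivial W] {h : ℂ} :
    Integrable (fun u => (‖W.starProjection u.1‖ : ℂ) ^ h) (volume : Measure E).toSphere ↔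
      dim W = dim E ∨ -(dim W : ℝ) < h.re := by
  have hψ : ∀ r ∈ Ioo (0 : ℝ) 1, ((-r ^ 2).exp : ℂ) ≠ 0 := fun r _ =>
    Complex.ofReal_ne_zero.2 (Real.exp_ne_zero _)
  constructor
  · intro hi
    by_contra! hc
    have hlt : dim W < dim E := lt_of_le_of_ne W.finrank_le hc.1
    have h1 : Integrable (fun u => (‖W.starProjection u.1‖ : ℂ) ^ (-(dim W : ℝ) : ℂ))
        (volume : Measure E).toSphere := by
      refine hi.norm.mono' ((measurable_norm_starProjection_cpow W _).comp
        measurable_subtype_coe).aestronglyMeasurable ?_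
      filter_upwards [ae_toSphere_starProjection_ne_zero W] with u hu
      have hpos := norm_pos_iff.2 hu
      rw [Complex.norm_cpow_eq_rpow_re_of_pos hpos, Complex.norm_cpow_eq_rpow_re_of_pos hpos]
      refine Real.rpow_le_rpow_of_exponent_ge hpos ?_ (by simpa using hc.2)
      calc ‖W.starProjection u.1‖ ≤ ‖u.1‖ := W.norm_starProjection_apply_le _
        _ = 1 := norm_eq_of_mem_sphere u
    have h2 := (integrable_proj_radial_iff W (h := (-(dim W : ℝ) : ℂ)) hψ).2 ⟨h1, by
      rw [← integrable_norm_radial_iff hψ, integrable_norm_cpow_mul_exp_iff]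
      simpa using hlt⟩
    rw [integrable_proj_gauss_iff] at h2
    simp at h2
  · rintro (h1 | h1)
    · have hW : W = ⊤ := Submodule.eq_top_of_finrank_eq h1
      subst hW
      simp [Submodule.starProjection_top]
    · exact ((integrable_proj_radial_iff W hψ).1 ((integrable_proj_gauss_iff W h).2 h1)).1

omit [Nontrivial E] in
lemma integral_norm_sphere_of_finrank_eq {W : Submodule ℝ E} (hW : dim W = dim E) (h : ℂ) :
    ∫ u, (‖W.starProjection u.1‖ : ℂ) ^ h ∂(volume : Measure E).toSphere =
      ((volume : Measure E).toSphere.real univ : ℂ) := by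
  have hW : W = ⊤ := Submodule.eq_top_of_finrank_eq hW
  subst hW
  simp [Submodule.starProjection_top]

/-- The Gaussian integrals for `W` and for the whole space share their radial factor, so their
quotient is the normalised spherical moment. -/
lemma integral_norm_sphere (W : Submodule ℝ E) [Nontrivial W] {h : ℂ} (hh : -(dim W : ℝ) < h.re) :
    ∫ u, (‖W.starProjection u.1‖ : ℂ) ^ h ∂(volume : Measure E).toSphere =
      ((volume : Measure E).toSphere.real univ : ℂ) *
        (gammaMoment (dim W) h / gammaMoment (dim E) h) := by
  have hle : (dim W : ℝ) ≤ dim E := Nat.cast_le.2 W.finrank_le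
  have h1 := integral_proj_radial W h (fun r => ((-r ^ 2).exp : ℂ))
  have h2 := integral_norm_radial (E := E) h (fun r => ((-r ^ 2).exp : ℂ))
  have hE : -(dim E : ℝ) < h.re := by linarith
  rw [integral_proj_gauss W hh] at h1
  rw [integral_norm_cpow_mul_exp hE] at h2
  change _ * gammaMoment _ _ = _ at h1 h2
  have h3 := gammaMoment_ne_zero (Module.finrank_pos (R := ℝ) (M := E)) hE
  have hpi : (Real.pi : ℂ) ^ ((dim E : ℂ) / 2) ≠ 0 := by
    simp [Complex.cpow_eq_zero_iff, Real.pi_ne_zero]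
  rw [mul_div_assoc', eq_div_iff h3]
  refine mul_left_cancel₀ hpi ?_
  rw [mul_left_comm, h2, mul_left_comm (_ ^ _), h1]
  ring

lemma integrableOn_norm_cpow_ball_iff {h : ℂ} :
    IntegrableOn (fun v : E => (‖v‖ : ℂ) ^ h) (Metric.ball 0 1) ↔ -(dim E : ℝ) < h.re := by
  rw [integrableOn_fun_norm_addHaar volume (f := fun y : ℝ => (y : ℂ) ^ h),
    integrableOn_congr_fun (fun y (hy : y ∈ Ioo (0 : ℝ) 1) =>
      pow_smul_cpow hy.1 (Module.finrank_pos (R := ℝ) (M := E)).ne' h) measurableSet_Ioo,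
    intervalIntegral.integrableOn_Ioo_cpow_iff one_pos]
  simp only [Complex.sub_re, Complex.add_re, Complex.natCast_re, Complex.one_re]
  constructor <;> intro h <;> linarith

lemma integral_norm_cpow_ball {h : ℂ} (hh : -(dim E : ℝ) < h.re) :
    ∫ v in Metric.ball (0 : E) 1, (‖v‖ : ℂ) ^ h =
      ((volume : Measure E).real (Metric.ball 0 1) : ℂ) * ((dim E : ℂ) / ((dim E : ℂ) + h)) := by
  rw [← integral_indicator measurableSet_ball, ← indicator_ball_eq,
    integral_fun_norm_addHaar volume (fun y : ℝ => (y : ℂ) ^ h * (Iio (1 : ℝ)).indicator 1 y)]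
  have h1 : ∫ y in Ioi (0 : ℝ), y ^ (dim E - 1) • ((y : ℂ) ^ h * (Iio (1 : ℝ)).indicator 1 y) =
      1 / ((dim E : ℂ) + h) := by
    have h2 : ∀ y ∈ Ioi (0 : ℝ), y ^ (dim E - 1) • ((y : ℂ) ^ h * (Iio (1 : ℝ)).indicator 1 y) =
        (Iio (1 : ℝ)).indicator (fun y : ℝ => (y : ℂ) ^ ((dim E : ℂ) + h - 1)) y := by
      intro y hy
      rw [← smul_mul_assoc, pow_smul_cpow hy (Module.finrank_pos (R := ℝ) (M := E)).ne']
      by_cases hy1 : y < 1 <;> simp [hy1]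
    rw [setIntegral_congr_fun measurableSet_Ioi h2, setIntegral_indicator measurableSet_Iio,
      Ioi_inter_Iio, ← integral_Ioc_eq_integral_Ioo,
      ← intervalIntegral.integral_of_le zero_le_one, integral_cpow]
    · have h3 : (dim E : ℂ) + h ≠ 0 := by
        intro h0
        have := congrArg Complex.re h0
        simp at this
        linarith
      simp [h3]
    · left
      simp only [Complex.sub_re, Complex.add_re, Complex.natCast_re, Complex.one_re]
      linarith
  rw [h1]
  simp only [nsmul_eq_mul, Complex.real_smul]
  ring

lemma integrableOn_proj_ball_iff (W : Submodule ℝ E) [Nontrivial W] {h : ℂ} :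
    IntegrableOn (fun v : E => (‖W.starProjection v‖ : ℂ) ^ h) (Metric.ball 0 1) ↔
      -(dim W : ℝ) < h.re := by
  have hle : (dim W : ℝ) ≤ dim E := Nat.cast_le.2 W.finrank_le
  have hψ : ∀ r ∈ Ioo (0 : ℝ) 1, (Iio (1 : ℝ)).indicator (1 : ℝ → ℂ) r ≠ 0 := fun r hr => by
    simp [hr.2]
  rw [← integrable_indicator_iff measurableSet_ball, ← indicator_ball_eq,
    integrable_proj_radial_iff W hψ, ← integrable_norm_radial_iff hψ, indicator_ball_eq,
    integrable_indicator_iff measurableSet_ball, integrableOn_norm_cpow_ball_iff,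
    integrable_norm_sphere_iff]
  -- When `W` is the whole space the spherical factor imposes nothing and the radial condition is
  -- the bound; in general the bound for `W` implies the radial one.
  constructor
  · rintro ⟨h1 | h1, h2⟩
    · rwa [h1]
    · exact h1
  · exact fun h1 => ⟨Or.inr h1, by linarith⟩

lemma integral_proj_ball (W : Submodule ℝ E) [Nontrivial W] {h : ℂ} (hh : -(dim W : ℝ) < h.re) :
    ∫ v in Metric.ball (0 : E) 1, (‖W.starProjection v‖ : ℂ) ^ h =
      ((volume : Measure E).real (Metric.ball 0 1) : ℂ) *
        (gammaMoment (dim W) h / gammaMoment (dim E) h * ((dim E : ℂ) / ((dim E : ℂ) + h))) := by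
  have hle : (dim W : ℝ) ≤ dim E := Nat.cast_le.2 W.finrank_le
  have h1 := integral_proj_radial W h ((Iio (1 : ℝ)).indicator 1)
  have h2 := integral_norm_radial (E := E) h ((Iio (1 : ℝ)).indicator 1)
  rw [indicator_ball_eq, integral_indicator measurableSet_ball] at h1 h2
  rw [integral_norm_cpow_ball (by linarith)] at h2
  rw [h1, integral_norm_sphere W hh, mul_left_comm, h2]
  ring

end Vector

/-! ### Induction on the number of independent columns. -/

variable {β : DysonIndex} {n N : ℕ}

/-- The law `μ` on `(𝔽_β)ⁿ` does not charge proper subspaces, and the moment of order `h` of the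
norm of the projection of a vector to a real subspace of dimension `β k` exists under the condition
`I h k` only, and is `C h k` then. -/
structure HasProjMoments (μ : Measure (ColVec β n)) (I : ℂ → ℕ → Prop) (C : ℂ → ℕ → ℂ) :
    Prop where
  null : ∀ V : Submodule ℝ (ColVec β n), V ≠ ⊤ → μ V = 0
  integrable_iff : ∀ (h : ℂ) (k : ℕ) (W : Submodule ℝ (ColVec β n)), 0 < k →
    Module.finrank ℝ W = β.val * k →
    (Integrable (fun v => (‖W.starProjection v‖ : ℂ) ^ h) μ ↔ I h k)
  integral_eq : ∀ (h : ℂ) (k : ℕ) (W : Submodule ℝ (ColVec β n)), 0 < k →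
    Module.finrank ℝ W = β.val * k → I h k → ∫ v, (‖W.starProjection v‖ : ℂ) ^ h ∂μ = C h k
  re_iff : ∀ h k, I (h.re : ℂ) k ↔ I h k
  ne_zero : ∀ h k, 0 < k → k ≤ n → I h k → C h k ≠ 0

lemma dysonIndex_val_pos (β : DysonIndex) : 0 < β.val := by
  cases β <;> simp [DysonIndex.val]

lemma nontrivial_of_finrank {V : Type*} [AddCommGroup V] [Module ℝ V] [FiniteDimensional ℝ V]
    {k : ℕ} (hk : 0 < k) (hV : Module.finrank ℝ V = β.val * k) : Nontrivial V :=
  Module.nontrivial_of_finrank_pos (R := ℝ) (hV ▸ Nat.mul_pos (dysonIndex_val_pos β) hk)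

lemma finrank_orthogonal_rightSpan {m : Fin N → ColVec β n}
    (hm : gramDet β (ofColumns m) ≠ 0) :
    Module.finrank ℝ (rightSpan m)ᗮ = β.val * (n - N) := by
  have := (rightSpan m).finrank_add_finrank_orthogonal
  rw [finrank_rightSpan hm, finrank_colVec] at this
  rw [Nat.mul_sub]
  omega

/-- The splitting of a sequence of columns into the later ones and the first. -/
def consEquiv (β : DysonIndex) (n N : ℕ) :
    (Fin (N + 1) → ColVec β n) ≃ᵐ (Fin N → ColVec β n) × ColVec β n :=
  (MeasurableEquiv.piFinSuccAbove (fun _ => ColVec β n) 0).trans MeasurableEquiv.prodComm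

lemma consEquiv_symm_apply (p : (Fin N → ColVec β n) × ColVec β n) :
    (consEquiv β n N).symm p = (Fin.cons p.2 p.1 : Fin (N + 1) → ColVec β n) := by
  simp [consEquiv, MeasurableEquiv.piFinSuccAbove_symm_apply]
  rfl

lemma measurePreserving_consEquiv (μ : Measure (ColVec β n)) [IsProbabilityMeasure μ] :
    MeasurePreserving (consEquiv β n N) (iidColumns μ (N + 1)) ((iidColumns μ N).prod μ) :=
  (measurePreserving_piFinSuccAbove (fun _ => μ) 0).trans Measure.measurePreserving_swap

instance instIsProbabilityMeasureIidColumns (μ : Measure (ColVec β n)) [IsProbabilityMeasure μ] :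
    IsProbabilityMeasure (iidColumns μ N) :=
  inferInstanceAs (IsProbabilityMeasure (Measure.pi fun _ => μ))

namespace HasProjMoments

variable {μ : Measure (ColVec β n)} [IsProbabilityMeasure μ] {I : ℂ → ℕ → Prop} {C : ℂ → ℕ → ℂ}
  (H : HasProjMoments μ I C)

include H

omit [IsProbabilityMeasure μ] in
lemma ae_starProjection_ne_zero (W : Submodule ℝ (ColVec β n)) [Nontrivial W] :
    ∀ᵐ v ∂μ, W.starProjection v ≠ 0 := by
  filter_upwards [compl_mem_ae_iff.2 (H.null _ (orthogonal_ne_top W))] with v hv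
  rwa [Ne, starProjection_eq_zero_iff_mem]

omit [IsProbabilityMeasure μ] in
-- For a positive base the modulus of a complex power depends only on the real part of the exponent,
-- so the absolute moment is again one of the moments `C`.
lemma integral_norm_eq {h : ℂ} {k : ℕ} {W : Submodule ℝ (ColVec β n)} (hk : 0 < k)
    (hW : Module.finrank ℝ W = β.val * k) (hI : I h k) :
    ((∫ v, ‖(‖W.starProjection v‖ : ℂ) ^ h‖ ∂μ : ℝ) : ℂ) = C h.re k := by
  have := nontrivial_of_finrank hk hW
  rw [← H.integral_eq _ k W hk hW ((H.re_iff h k).2 hI), ← integral_complex_ofReal]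
  refine integral_congr_ae ?_
  filter_upwards [H.ae_starProjection_ne_zero W] with v hv
  rw [Complex.norm_cpow_eq_rpow_re_of_pos (norm_pos_iff.2 hv),
    Complex.ofReal_cpow (norm_nonneg _)]

/-- Fewer than `n` columns span a proper subspace, which the law of the next column does not charge.
-/
lemma ae_gramDet_ne_zero (hN : N ≤ n) :
    ∀ᵐ m ∂iidColumns μ N, gramDet β (ofColumns m) ≠ 0 := by
  induction N with
  | zero => exact Filter.Eventually.of_forall fun m => by simp [gramDet_zero]
  | succ N ih =>
    have hs : MeasurableSet {p : (Fin N → ColVec β n) × ColVec β n |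
        gramDet β (ofColumns ((consEquiv β n N).symm p)) ≠ 0} :=
      (continuous_gramDet.measurable.comp (consEquiv β n N).symm.measurable)
        (measurableSet_singleton 0).compl
    have h1 : ∀ᵐ p ∂(iidColumns μ N).prod μ,
        gramDet β (ofColumns ((consEquiv β n N).symm p)) ≠ 0 := by
      rw [Measure.ae_prod_iff_ae_ae hs]
      filter_upwards [ih (by omega)] with m hm
      have := nontrivial_of_finrank (β := β) (by omega) (finrank_orthogonal_rightSpan hm)
      filter_upwards [H.ae_starProjection_ne_zero (rightSpan m)ᗮ] with w hw
      rw [consEquiv_symm_apply, gramDet_cons hm]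
      exact mul_ne_zero hm (pow_ne_zero _ (norm_ne_zero_iff.2 hw))
    have h2 := (measurePreserving_consEquiv μ).quasiMeasurePreserving.ae h1
    simpa using h2

/-- By Tonelli, integrability splits into that of almost every slice, which is `I h (n - N)`, and
that of the slicewise absolute integral, which is `‖gramPow h m‖` times a nonzero constant and so
falls under the induction hypothesis. -/
lemma integrable_gramPow_iff (h : ℂ) (hN : N ≤ n) :
    Integrable (gramPow h) (iidColumns μ N) ↔ ∀ j < N, I h (n - j) := by
  induction N with
  | zero =>
    simp only [Nat.not_lt_zero, false_imp_iff, implies_true, iff_true]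
    have : (gramPow h : (Fin 0 → ColVec β n) → ℂ) = fun _ => 1 := by
      funext m; simp [gramPow, gramDet_zero]
    rw [this]
    exact integrable_const _
  | succ N ih =>
    have hk : 0 < n - N := by omega
    have hae := H.ae_gramDet_ne_zero (N := N) (by omega)
    rw [← (measurePreserving_consEquiv μ).symm.integrable_comp_emb
      (consEquiv β n N).symm.measurableEmbedding, integrable_prod_iff
      ((measurable_gramPow h).comp (consEquiv β n N).symm.measurable).aestronglyMeasurable]
    simp only [Function.comp_def, consEquiv_symm_apply]
    have hslice : ∀ m : Fin N → ColVec β n, gramDet β (ofColumns m) ≠ 0 →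
        (Integrable (fun w => gramPow h (Fin.cons w m : Fin (N + 1) → ColVec β n)) μ ↔
          I h (n - N)) := by
      intro m hm
      have hne : gramPow h m ≠ 0 := by
        simp [gramPow, Complex.cpow_eq_zero_iff, hm]
      simp only [gramPow_cons h hm]
      rw [integrable_const_mul_iff (isUnit_iff_ne_zero.2 hne),
        H.integrable_iff h _ _ hk (finrank_orthogonal_rightSpan hm)]
    have hI : (∀ᵐ m ∂iidColumns μ N,
        Integrable (fun w => gramPow h (Fin.cons w m : Fin (N + 1) → ColVec β n)) μ) ↔
          I h (n - N) := by
      constructor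
      · intro h1
        obtain ⟨m, hm, hm'⟩ := (h1.and hae).exists
        exact (hslice m hm').1 hm
      · intro h1
        filter_upwards [hae] with m hm
        exact (hslice m hm).2 h1
    have hnorm : I h (n - N) → (Integrable (fun m => ∫ w,
        ‖gramPow h (Fin.cons w m : Fin (N + 1) → ColVec β n)‖ ∂μ) (iidColumns μ N) ↔
          Integrable (gramPow h) (iidColumns μ N)) := by
      intro h1
      have hC := H.ne_zero _ _ hk (Nat.sub_le _ _) ((H.re_iff h (n - N)).2 h1)
      have h2 : (fun m => ∫ w, ‖gramPow h (Fin.cons w m : Fin (N + 1) → ColVec β n)‖ ∂μ)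
          =ᵐ[iidColumns μ N] fun m => ‖gramPow h m‖ * (C h.re (n - N)).re := by
        filter_upwards [hae] with m hm
        have h3 := H.integral_norm_eq hk (finrank_orthogonal_rightSpan hm) h1
        simp only [gramPow_cons h hm, norm_mul]
        rw [integral_const_mul, ← h3, Complex.ofReal_re]
      -- The constant is an integral of norms, hence real, so it can only be nonzero through its
      -- real part.
      have hC' : (C h.re (n - N)).re ≠ 0 := by
        obtain ⟨m, hm⟩ := hae.exists
        have h3 := H.integral_norm_eq hk (finrank_orthogonal_rightSpan hm) h1
        rw [← h3] at hC ⊢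
        exact_mod_cast hC
      rw [integrable_congr h2, integrable_mul_const_iff (isUnit_iff_ne_zero.2 hC'),
        integrable_norm_iff (measurable_gramPow h).aestronglyMeasurable]
    rw [hI]
    constructor
    · rintro ⟨h1, h2⟩ j hj
      rcases Nat.lt_succ_iff_lt_or_eq.1 hj with hj | rfl
      · exact (ih (by omega)).1 ((hnorm h1).1 h2) j hj
      · exact h1
    · intro h1
      exact ⟨h1 N (by omega), (hnorm (h1 N (by omega))).2
        ((ih (by omega)).2 fun j hj => h1 j (by omega))⟩

lemma integral_gramPow {h : ℂ} (hN : N ≤ n) (hI : ∀ j < N, I h (n - j)) :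
    ∫ m, gramPow h m ∂iidColumns μ N = ∏ j ∈ Finset.range N, C h (n - j) := by
  induction N with
  | zero => simp [gramPow, gramDet_zero]
  | succ N ih =>
    have hk : 0 < n - N := by omega
    have hint := (H.integrable_gramPow_iff h hN).2 hI
    rw [← (measurePreserving_consEquiv μ).symm.integrable_comp_emb
      (consEquiv β n N).symm.measurableEmbedding, Function.comp_def] at hint
    rw [← (measurePreserving_consEquiv μ).symm.integral_comp
      (consEquiv β n N).symm.measurableEmbedding, integral_prod _ hint, Finset.prod_range_succ,
      ← ih (by omega) fun j hj => hI j (by omega), ← integral_mul_const]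
    refine integral_congr_ae ?_
    filter_upwards [H.ae_gramDet_ne_zero (N := N) (by omega)] with m hm
    simp only [consEquiv_symm_apply, gramPow_cons h hm]
    rw [integral_const_mul, H.integral_eq h _ _ hk (finrank_orthogonal_rightSpan hm)
      (hI N (by omega))]

end HasProjMoments

lemma nontrivial_colVec (hn : 0 < n) : Nontrivial (ColVec β n) :=
  nontrivial_of_finrank (β := β) hn (finrank_colVec β n)

lemma finrank_le_real {k : ℕ} (hkn : k ≤ n) : ((β.val * k : ℕ) : ℝ) ≤ ((β.val * n : ℕ) : ℝ) :=
  Nat.cast_le.2 (Nat.mul_le_mul_left _ hkn)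

/-! ### The one-vector moments of the three laws. -/

section Gauss

lemma gauss_const_mul (β : DysonIndex) (n : ℕ) :
    (1 / Real.pi) ^ ((β.val : ℝ) * n / 2) * Real.pi ^ (((β.val * n : ℕ) : ℝ) / 2) = 1 := by
  push_cast
  rw [← Real.mul_rpow (by positivity) Real.pi_pos.le, one_div, inv_mul_cancel₀ Real.pi_ne_zero,
    Real.one_rpow]

lemma integrable_gaussLaw_iff {g : ColVec β n → ℂ} :
    Integrable g (gaussLaw β n) ↔ Integrable fun v => g v * ((-‖v‖ ^ 2).exp : ℂ) := by
  rw [gaussLaw, integrable_withDensity_iff_integrable_smul' (by fun_prop) (by simp)]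
  have hc : IsUnit (((1 / Real.pi) ^ ((β.val : ℝ) * n / 2) : ℝ) : ℂ) :=
    isUnit_iff_ne_zero.2 (Complex.ofReal_ne_zero.2 (by positivity))
  refine Iff.trans ?_ (integrable_const_mul_iff hc _)
  refine integrable_congr (Filter.Eventually.of_forall fun v => ?_)
  simp only
  rw [ENNReal.toReal_ofReal (by positivity), Complex.real_smul]
  push_cast
  ring

lemma integral_gaussLaw (g : ColVec β n → ℂ) :
    ∫ v, g v ∂gaussLaw β n =
      (((1 / Real.pi) ^ ((β.val : ℝ) * n / 2) : ℝ) : ℂ) *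
        ∫ v, g v * ((-‖v‖ ^ 2).exp : ℂ) := by
  rw [gaussLaw, integral_withDensity_eq_integral_toReal_smul (by fun_prop) (by simp),
    ← integral_const_mul]
  refine integral_congr_ae (Filter.Eventually.of_forall fun v => ?_)
  simp only
  rw [ENNReal.toReal_ofReal (by positivity), Complex.real_smul]
  push_cast
  ring

instance instIsProbabilityMeasureGaussLaw : IsProbabilityMeasure (gaussLaw β n) := by
  constructor
  have h1 : ∫ v : ColVec β n, Real.exp (-‖v‖ ^ 2) = Real.pi ^ (((β.val * n : ℕ) : ℝ) / 2) := by
    have := GaussianFourier.integral_rexp_neg_mul_sq_norm (V := ColVec β n) one_pos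
    simpa only [neg_mul, one_mul, div_one, finrank_colVec] using this
  have h2 : Integrable fun v : ColVec β n => Real.exp (-‖v‖ ^ 2) :=
    Integrable.of_integral_ne_zero (by rw [h1]; positivity)
  rw [gaussLaw, withDensity_apply _ .univ, Measure.restrict_univ,
    ← ofReal_integral_eq_lintegral_ofReal (h2.const_mul _)
      (Filter.Eventually.of_forall fun v => by positivity),
    integral_const_mul, h1, gauss_const_mul, ENNReal.ofReal_one]

lemma hasProjMoments_gaussLaw :
    HasProjMoments (gaussLaw β n) (fun h k => -((β.val * k : ℕ) : ℝ) < h.re)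
      (fun h k => gammaMoment (β.val * k) h) where
  null V hV := withDensity_absolutelyContinuous _ _ (Measure.addHaar_submodule _ V hV)
  integrable_iff h k W hk hW := by
    have := nontrivial_of_finrank hk hW
    rw [integrable_gaussLaw_iff, integrable_proj_gauss_iff, hW]
  integral_eq h k W hk hW hI := by
    have := nontrivial_of_finrank hk hW
    rw [integral_gaussLaw, integral_proj_gauss W (by rwa [hW]), hW, finrank_colVec, ← mul_assoc]
    have h1 := congrArg (fun t : ℝ => (t : ℂ)) (gauss_const_mul β n)
    simp only [Complex.ofReal_mul, Complex.ofReal_one] at h1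
    rw [Complex.ofReal_cpow Real.pi_pos.le] at h1
    rw [gammaMoment]
    convert one_mul _ using 2
    rw [← h1]
    push_cast
    rfl
  re_iff h k := by simp
  ne_zero h k hk _ hI := gammaMoment_ne_zero (Nat.mul_pos (dysonIndex_val_pos β) hk) hI

end Gauss

section Sphere

lemma isProbabilityMeasure_sphereLaw (hn : 0 < n) : IsProbabilityMeasure (sphereLaw β n) := by
  have := nontrivial_colVec (β := β) hn
  constructor
  rw [sphereLaw, Measure.smul_apply, Measure.map_apply measurable_subtype_coe .univ,
    Set.preimage_univ, smul_eq_mul, ENNReal.inv_mul_cancel (Measure.measure_univ_ne_zero.2 (Measure.toSphere_ne_zero _)) (measure_ne_top _ _)]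

/-- The value `k = n` is kept apart because the norm of the full vector is 1: its moments exist and
equal 1 for every `h`, even where the Gamma quotient would be meaningless. -/
lemma hasProjMoments_sphereLaw (hn : 0 < n) :
    HasProjMoments (sphereLaw β n) (fun h k => k = n ∨ -((β.val * k : ℕ) : ℝ) < h.re)
      (fun h k => if k = n then 1 else gammaMoment (β.val * k) h / gammaMoment (β.val * n) h) := by
  have := nontrivial_colVec (β := β) hn
  have h0 : (volume : Measure (ColVec β n)).toSphere Set.univ ≠ 0 :=
    Measure.measure_univ_ne_zero.2 (Measure.toSphere_ne_zero _)
  have h0' : (volume : Measure (ColVec β n)).toSphere Set.univ ≠ ⊤ := measure_ne_top _ _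
  have h1 : (((volume : Measure (ColVec β n)).toSphere Set.univ).toReal : ℂ) ≠ 0 :=
    Complex.ofReal_ne_zero.2 (ENNReal.toReal_ne_zero.2 ⟨h0, h0'⟩)
  have hinj : ∀ k, β.val * k = β.val * n ↔ k = n := fun k =>
    Nat.mul_right_inj (dysonIndex_val_pos β).ne'
  refine ⟨fun V hV => ?_, fun h k W hk hW => ?_, fun h k W hk hW hI => ?_, fun h k => by simp,
    fun h k hk hkn hI => ?_⟩
  · rw [sphereLaw, Measure.smul_apply, Measure.map_apply measurable_subtype_coe
      V.closed_of_finiteDimensional.measurableSet]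
    have := toSphere_submodule_eq_zero hV
    rw [show Subtype.val ⁻¹' (V : Set (ColVec β n)) = {u | u.1 ∈ V} from rfl, this, smul_zero]
  · have := nontrivial_of_finrank hk hW
    rw [sphereLaw, integrable_smul_measure (ENNReal.inv_ne_zero.2 h0') (ENNReal.inv_ne_top.2 h0),
      integrable_map_measure (measurable_norm_starProjection_cpow W h).aestronglyMeasurable
        measurable_subtype_coe.aemeasurable, Function.comp_def, integrable_norm_sphere_iff, hW,
      finrank_colVec, hinj]
  · have := nontrivial_of_finrank hk hW
    rw [sphereLaw, integral_smul_measure, integral_map measurable_subtype_coe.aemeasurable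
      (measurable_norm_starProjection_cpow W h).aestronglyMeasurable, ENNReal.toReal_inv,
      Complex.real_smul, Complex.ofReal_inv, inv_mul_eq_iff_eq_mul₀ h1]
    split_ifs with hkn
    · rw [integral_norm_sphere_of_finrank_eq (by rw [hW, finrank_colVec, hkn]), mul_one]
      rfl
    · rw [integral_norm_sphere W (by rw [hW]; exact hI.resolve_left hkn), hW, finrank_colVec]
      rfl
  · split_ifs with hkn'
    · exact one_ne_zero
    · have hI := hI.resolve_left hkn'
      have := finrank_le_real (β := β) hkn
      exact div_ne_zero (gammaMoment_ne_zero (Nat.mul_pos (dysonIndex_val_pos β) hk) hI)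
        (gammaMoment_ne_zero (Nat.mul_pos (dysonIndex_val_pos β) hn) (by linarith))

end Sphere

section Ball

lemma ballLaw_eq (hn : 0 < n) :
    ballLaw β n = (volume (Metric.ball (0 : ColVec β n) 1))⁻¹ •
      (volume : Measure (ColVec β n)).restrict (Metric.ball 0 1) := by
  have := nontrivial_colVec (β := β) hn
  rw [ballLaw, ProbabilityTheory.cond, Measure.addHaar_closedBall_eq_addHaar_ball]
  congr 1
  refine (Measure.restrict_congr_set ?_).symm
  refine ae_eq_of_subset_of_measure_ge Metric.ball_subset_closedBall
    (Measure.addHaar_closedBall_eq_addHaar_ball _ _ _).le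
    measurableSet_ball.nullMeasurableSet measure_closedBall_lt_top.ne

lemma isProbabilityMeasure_ballLaw : IsProbabilityMeasure (ballLaw β n) :=
  ProbabilityTheory.cond_isProbabilityMeasure_of_finite
    (Metric.measure_closedBall_pos _ _ one_pos).ne' measure_closedBall_lt_top.ne

lemma hasProjMoments_ballLaw (hn : 0 < n) :
    HasProjMoments (ballLaw β n) (fun h k => -((β.val * k : ℕ) : ℝ) < h.re)
      (fun h k => gammaMoment (β.val * k) h / gammaMoment (β.val * n) h *
        (((β.val * n : ℕ) : ℂ) / (((β.val * n : ℕ) : ℂ) + h))) := by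
  have := nontrivial_colVec (β := β) hn
  have h0 : volume (Metric.ball (0 : ColVec β n) 1) ≠ 0 := (Metric.measure_ball_pos _ _ one_pos).ne'
  have h0' : volume (Metric.ball (0 : ColVec β n) 1) ≠ ⊤ := measure_ball_lt_top.ne
  have h1 : ((volume (Metric.ball (0 : ColVec β n) 1)).toReal : ℂ) ≠ 0 :=
    Complex.ofReal_ne_zero.2 (ENNReal.toReal_ne_zero.2 ⟨h0, h0'⟩)
  refine ⟨fun V hV => ?_, fun h k W hk hW => ?_, fun h k W hk hW hI => ?_, fun h k => by simp,
    fun h k hk hkn hI => ?_⟩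
  · rw [ballLaw_eq hn, Measure.smul_apply, Measure.absolutelyContinuous_of_le
      Measure.restrict_le_self (Measure.addHaar_submodule _ V hV), smul_zero]
  · have := nontrivial_of_finrank hk hW
    rw [ballLaw_eq hn, integrable_smul_measure (ENNReal.inv_ne_zero.2 h0')
      (ENNReal.inv_ne_top.2 h0)]
    exact (integrableOn_proj_ball_iff W).trans (by rw [hW])
  · have := nontrivial_of_finrank hk hW
    rw [ballLaw_eq hn, integral_smul_measure, ENNReal.toReal_inv,
      Complex.real_smul, Complex.ofReal_inv, inv_mul_eq_iff_eq_mul₀ h1,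
      integral_proj_ball W (by rwa [hW]), hW, finrank_colVec]
    rfl
  · have := finrank_le_real (β := β) hkn
    have hDpos : 0 < β.val * n := Nat.mul_pos (dysonIndex_val_pos β) hn
    refine mul_ne_zero (div_ne_zero
      (gammaMoment_ne_zero (Nat.mul_pos (dysonIndex_val_pos β) hk) hI)
      (gammaMoment_ne_zero hDpos (by linarith))) (div_ne_zero (Nat.cast_ne_zero.2 hDpos.ne') ?_)
    intro h2
    have := congrArg Complex.re h2
    rw [Complex.add_re, Complex.natCast_re, Complex.zero_re] at this
    linarith

end Ball

/-! ### From Gamma quotients to sphere areas. -/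

section ClosedForms

lemma sphereArea_ne_zero {l : ℂ} (hl : 0 < l.re) : sphereArea l ≠ 0 := by
  refine div_ne_zero (mul_ne_zero two_ne_zero ?_) (Complex.Gamma_ne_zero_of_re_pos ?_)
  · simp [Complex.cpow_eq_zero_iff, Real.pi_ne_zero]
  · simpa using hl

lemma sphereArea_div {d : ℕ} (hd : 0 < d) {h : ℂ} (hh : -(d : ℝ) < h.re) :
    sphereArea d / sphereArea (d + h) = (Real.pi : ℂ) ^ (-h / 2) * gammaMoment d h := by
  have hpi : (Real.pi : ℂ) ≠ 0 := Complex.ofReal_ne_zero.2 Real.pi_ne_zero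
  have h1 : Complex.Gamma ((d : ℂ) / 2) ≠ 0 :=
    Complex.Gamma_ne_zero_of_re_pos (by simpa using hd)
  have h2 : Complex.Gamma (((d : ℂ) + h) / 2) ≠ 0 :=
    Complex.Gamma_ne_zero_of_re_pos (by simp; linarith)
  have h3 : (Real.pi : ℂ) ^ ((d : ℂ) / 2) =
      (Real.pi : ℂ) ^ (-h / 2) * (Real.pi : ℂ) ^ (((d : ℂ) + h) / 2) := by
    rw [← Complex.cpow_add _ _ hpi]
    congr 1
    ring
  have h4 : (Real.pi : ℂ) ^ (((d : ℂ) + h) / 2) ≠ 0 := by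
    simp [Complex.cpow_eq_zero_iff, Real.pi_ne_zero]
  rw [sphereArea, sphereArea, gammaMoment, h3]
  field_simp

lemma areaRatio_eq_prod_range (β : DysonIndex) (N : ℕ) (x y : ℂ) :
    areaRatio β N x y = ∏ j ∈ Finset.range N,
      sphereArea ((β.val : ℂ) * (x - j)) / sphereArea ((β.val : ℂ) * (y - j)) := by
  rw [areaRatio, ← Finset.Ico_succ_right_eq_Icc, Order.succ_eq_add_one,
    Finset.prod_Ico_eq_prod_range, Nat.add_sub_cancel]
  refine Finset.prod_congr rfl fun j _ => ?_
  congr 3 <;> push_cast <;> ring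

lemma re_bound_of_lt {h : ℂ} (hh : -((β.val : ℝ) * (n - N + 1)) < h.re) {j : ℕ}
    (hj : j < N) (hN : N ≤ n) : -((β.val * (n - j) : ℕ) : ℝ) < h.re := by
  refine lt_of_le_of_lt ?_ hh
  rw [Nat.cast_mul, Nat.cast_sub (by omega), neg_le_neg_iff]
  have : (j : ℝ) + 1 ≤ N := by exact_mod_cast hj
  gcongr
  linarith

/-- The condition is strictest at `j = N - 1`, for the last column adjoined. -/
lemma forall_re_bound_iff {h : ℂ} (hN : 1 ≤ N) (hNn : N ≤ n) :
    (∀ j < N, -((β.val * (n - j) : ℕ) : ℝ) < h.re) ↔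
      -((β.val : ℝ) * (n - N + 1)) < h.re := by
  refine ⟨fun H => ?_, fun hh j hj => re_bound_of_lt hh hj hNn⟩
  have := H (N - 1) (by omega)
  rw [Nat.cast_mul, Nat.cast_sub (by omega), Nat.cast_sub hN] at this
  convert this using 4
  push_cast
  ring

/-- Since `β (x - j) = β (n - j) + h`, each factor is an instance of `sphereArea_div`, and the `N`
powers of `π` are collected in front. -/
lemma areaRatio_closed {h x : ℂ} (hNn : N ≤ n) (hh : -((β.val : ℝ) * (n - N + 1)) < h.re)
    (hx : x = n + h / (β.val : ℂ)) :
    areaRatio β N n x = (Real.pi : ℂ) ^ (-(N * h / 2)) *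
      ∏ j ∈ Finset.range N, gammaMoment (β.val * (n - j)) h := by
  have hβ : (β.val : ℂ) ≠ 0 := Nat.cast_ne_zero.2 (dysonIndex_val_pos β).ne'
  rw [areaRatio_eq_prod_range]
  have h1 : (Real.pi : ℂ) ^ (-(N * h / 2)) = ∏ _j ∈ Finset.range N, (Real.pi : ℂ) ^ (-h / 2) := by
    rw [Finset.prod_const, Finset.card_range, ← Complex.cpow_nat_mul]
    congr 1
    ring
  rw [h1, ← Finset.prod_mul_distrib]
  refine Finset.prod_congr rfl fun j hj => ?_
  have hj := Finset.mem_range.1 hj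
  rw [← sphereArea_div (Nat.mul_pos (dysonIndex_val_pos β) (by omega)) (re_bound_of_lt hh hj hNn)]
  rw [Nat.cast_mul, Nat.cast_sub (by omega), hx]
  congr 2
  field_simp
  ring

end ClosedForms

lemma val_mul_eq_add {h x : ℂ} (hx : x = n + h / (β.val : ℂ)) :
    (β.val : ℂ) * x = ((β.val * n : ℕ) : ℂ) + h := by
  have hβ : (β.val : ℂ) ≠ 0 := Nat.cast_ne_zero.2 (dysonIndex_val_pos β).ne'
  rw [hx]
  push_cast
  field_simp

lemma re_bound_self {h : ℂ} (hN : 1 ≤ N) (hNn : N ≤ n)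
    (hh : -((β.val : ℝ) * (n - N + 1)) < h.re) : -((β.val * n : ℕ) : ℝ) < h.re := by
  simpa using re_bound_of_lt hh hN hNn

lemma sphereArea_quotient {h x : ℂ} (hN : 1 ≤ N) (hNn : N ≤ n)
    (hh : -((β.val : ℝ) * (n - N + 1)) < h.re) (hx : x = n + h / (β.val : ℂ)) :
    sphereArea (β.val * x) / sphereArea (β.val * n) =
      (Real.pi : ℂ) ^ (h / 2) * (gammaMoment (β.val * n) h)⁻¹ := by
  have h1 := sphereArea_div (Nat.mul_pos (dysonIndex_val_pos β) (hN.trans hNn))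
    (re_bound_self hN hNn hh)
  rw [← inv_div, val_mul_eq_add hx, ← Nat.cast_mul, h1, mul_inv, neg_div, Complex.cpow_neg, inv_inv]

lemma areaRatio_mul_sphereArea_pow {h x : ℂ} (hN : 1 ≤ N) (hNn : N ≤ n)
    (hh : -((β.val : ℝ) * (n - N + 1)) < h.re) (hx : x = n + h / (β.val : ℂ)) :
    areaRatio β N n x * (sphereArea (β.val * x) / sphereArea (β.val * n)) ^ N =
      ∏ j ∈ Finset.range N, gammaMoment (β.val * (n - j)) h / gammaMoment (β.val * n) h := by
  have hpi : (Real.pi : ℂ) ^ (-(N * h / 2)) * ((Real.pi : ℂ) ^ (h / 2)) ^ N = 1 := by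
    rw [← Complex.cpow_nat_mul, ← Complex.cpow_add _ _ (Complex.ofReal_ne_zero.2 Real.pi_ne_zero)]
    convert Complex.cpow_zero _ using 2
    ring
  rw [areaRatio_closed hNn hh hx, sphereArea_quotient hN hNn hh hx, mul_pow, mul_mul_mul_comm, hpi,
    one_mul, Finset.prod_div_distrib, Finset.prod_const, Finset.card_range, inv_pow, div_eq_mul_inv]

lemma areaRatio_mul_pi_pow {h x : ℂ} (hNn : N ≤ n)
    (hh : -((β.val : ℝ) * (n - N + 1)) < h.re) (hx : x = n + h / (β.val : ℂ)) :
    areaRatio β N n x * (Real.pi : ℂ) ^ (N * h / 2) =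
      ∏ j ∈ Finset.range N, gammaMoment (β.val * (n - j)) h := by
  rw [areaRatio_closed hNn hh hx, mul_right_comm,
    ← Complex.cpow_add _ _ (Complex.ofReal_ne_zero.2 Real.pi_ne_zero), neg_add_cancel,
    Complex.cpow_zero, one_mul]

/-! ### Moments of the Gram determinant. -/

theorem integrable_gramPow_ball_iff (h : ℂ) (hN : 1 ≤ N) (hNn : N ≤ n) :
    Integrable (gramPow h) (iidColumns (ballLaw β n) N) ↔
      -((β.val : ℝ) * (n - N + 1)) < h.re := by
  have := isProbabilityMeasure_ballLaw (β := β) (n := n)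
  rw [(hasProjMoments_ballLaw (hN.trans hNn)).integrable_gramPow_iff h hNn,
    forall_re_bound_iff hN hNn]

theorem integral_gramPow_ball {h x : ℂ} (hN : 1 ≤ N) (hNn : N ≤ n)
    (hh : -((β.val : ℝ) * (n - N + 1)) < h.re) (hx : x = n + h / (β.val : ℂ)) :
    ∫ m, gramPow h m ∂iidColumns (ballLaw β n) N =
      areaRatio β N n x * (n * sphereArea (β.val * x) / (x * sphereArea (β.val * n))) ^ N := by
  have := isProbabilityMeasure_ballLaw (β := β) (n := n)
  have hβ : (β.val : ℂ) ≠ 0 := Nat.cast_ne_zero.2 (dysonIndex_val_pos β).ne'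
  rw [(hasProjMoments_ballLaw (hN.trans hNn)).integral_gramPow hNn
    ((forall_re_bound_iff hN hNn).2 hh), Finset.prod_mul_distrib, Finset.prod_const,
    Finset.card_range, ← areaRatio_mul_sphereArea_pow hN hNn hh hx, ← val_mul_eq_add hx, mul_assoc,
    ← mul_pow, Nat.cast_mul, mul_div_mul_left _ _ hβ, div_mul_div_comm,
    mul_comm (sphereArea _) (n : ℂ), mul_comm (sphereArea _) x]

theorem integrable_gramPow_gauss_iff (h : ℂ) (hN : 1 ≤ N) (hNn : N ≤ n) :
    Integrable (gramPow h) (iidColumns (gaussLaw β n) N) ↔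
      -((β.val : ℝ) * (n - N + 1)) < h.re := by
  rw [hasProjMoments_gaussLaw.integrable_gramPow_iff h hNn, forall_re_bound_iff hN hNn]

theorem integral_gramPow_gauss {h x : ℂ} (hN : 1 ≤ N) (hNn : N ≤ n)
    (hh : -((β.val : ℝ) * (n - N + 1)) < h.re) (hx : x = n + h / (β.val : ℂ)) :
    ∫ m, gramPow h m ∂iidColumns (gaussLaw β n) N =
      areaRatio β N n x * (Real.pi : ℂ) ^ (N * h / 2) := by
  rw [hasProjMoments_gaussLaw.integral_gramPow hNn ((forall_re_bound_iff hN hNn).2 hh),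
    areaRatio_mul_pi_pow hNn hh hx]

theorem integrable_gramPow_sphere_iff (h : ℂ) (hN : 1 ≤ N) (hNn : N ≤ n) :
    Integrable (gramPow h) (iidColumns (sphereLaw β n) N) ↔
      N = 1 ∨ -((β.val : ℝ) * (n - N + 1)) < h.re := by
  have := isProbabilityMeasure_sphereLaw (β := β) (hN.trans hNn)
  rw [(hasProjMoments_sphereLaw (hN.trans hNn)).integrable_gramPow_iff h hNn]
  constructor
  · intro H
    rcases hN.eq_or_lt with h1 | h1
    · exact Or.inl h1.symm
    · have h2 := (H (N - 1) (by omega)).resolve_left (by omega)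
      rw [Nat.cast_mul, Nat.cast_sub (by omega), Nat.cast_sub hN, Nat.cast_one] at h2
      exact Or.inr (by rwa [sub_sub_eq_add_sub, add_sub_right_comm] at h2)
  · rintro (rfl | hh) j hj
    · exact Or.inl (by omega)
    · exact Or.inr (re_bound_of_lt hh hj hNn)

theorem integral_gramPow_sphere {h x : ℂ} (hN : 1 ≤ N) (hNn : N ≤ n)
    (hh : -((β.val : ℝ) * (n - N + 1)) < h.re) (hx : x = n + h / (β.val : ℂ)) :
    ∫ m, gramPow h m ∂iidColumns (sphereLaw β n) N =
      areaRatio β N n x * (sphereArea (β.val * x) / sphereArea (β.val * n)) ^ N := by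
  have := isProbabilityMeasure_sphereLaw (β := β) (hN.trans hNn)
  rw [(hasProjMoments_sphereLaw (hN.trans hNn)).integral_gramPow hNn
    fun j hj => Or.inr (re_bound_of_lt hh hj hNn), areaRatio_mul_sphereArea_pow hN hNn hh hx]
  refine Finset.prod_congr rfl fun j _ => ?_
  -- Only `j = 0` reaches the separate value 1, which agrees with the quotient because the bound on
  -- `h.re` makes its denominator nonzero.
  split_ifs with hj
  · rw [hj, div_self (gammaMoment_ne_zero (Nat.mul_pos (dysonIndex_val_pos β) (hN.trans hNn))
      (re_bound_self hN hNn hh))]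
  · rfl

lemma integral_gramPow_sphere_one (h : ℂ) (hn : 1 ≤ n) :
    ∫ m, gramPow h m ∂iidColumns (sphereLaw β n) 1 = 1 := by
  have := isProbabilityMeasure_sphereLaw (β := β) hn
  rw [(hasProjMoments_sphereLaw hn).integral_gramPow hn fun j hj => Or.inl (by omega)]
  simp

lemma sphereArea_nat_ne_zero {k : ℕ} (hk : 0 < k) : sphereArea ((β.val : ℂ) * k) ≠ 0 :=
  sphereArea_ne_zero (by
    rw [← Nat.cast_mul, Complex.natCast_re]
    exact Nat.cast_pos.2 (Nat.mul_pos (dysonIndex_val_pos β) hk))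

lemma areaRatio_mul_areaRatio (x : ℂ) :
    areaRatio β N n N * areaRatio β N N x = areaRatio β N n x := by
  rw [areaRatio_eq_prod_range, areaRatio_eq_prod_range, areaRatio_eq_prod_range,
    ← Finset.prod_mul_distrib]
  refine Finset.prod_congr rfl fun j hj => div_mul_div_cancel₀ ?_
  have hj := Finset.mem_range.1 hj
  rw [← Nat.cast_sub hj.le]
  exact sphereArea_nat_ne_zero (by omega)

/-! ### Reduction to square matrices. -/

/-- When `p` fails neither function is integrable and both Bochner integrals are 0 by default, so
the identity only has to be checked under `p`. -/
lemma integrable_iff_and_integral_eq {α α' : Type*} [MeasurableSpace α] [MeasurableSpace α']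
    {μ : Measure α} {μ' : Measure α'} {f : α → ℂ} {g : α' → ℂ} {p : Prop} {c : ℂ}
    (hf : Integrable f μ ↔ p) (hg : Integrable g μ' ↔ p)
    (hfg : p → ∫ a, f a ∂μ = c * ∫ a, g a ∂μ') :
    (Integrable f μ ↔ Integrable g μ') ∧ ∫ a, f a ∂μ = c * ∫ a, g a ∂μ' := by
  refine ⟨hf.trans hg.symm, ?_⟩
  by_cases hp : p
  · exact hfg hp
  · rw [integral_undef (mt hf.1 hp), integral_undef (mt hg.1 hp), mul_zero]

lemma re_bound_square_iff {h : ℂ} :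
    -((β.val : ℝ) * (N - N + 1)) < (h + (β.val : ℂ) * (n - N)).re ↔
      -((β.val : ℝ) * (n - N + 1)) < h.re := by
  have : (h + (β.val : ℂ) * (n - N)).re = h.re + (β.val : ℝ) * (n - N) := by simp
  rw [this]
  constructor <;> intro h <;> linarith

/-- The shifted exponent in dimension `N` has the same parameter `x` as `h` in dimension `n`; this
is what makes the two closed forms comparable. -/
lemma exponent_square (h : ℂ) :
    (n : ℂ) + h / (β.val : ℂ) = N + (h + (β.val : ℂ) * (n - N)) / (β.val : ℂ) := by
  have hβ : (β.val : ℂ) ≠ 0 := Nat.cast_ne_zero.2 (dysonIndex_val_pos β).ne'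
  field_simp
  ring

theorem reduction_ball (h : ℂ) (hN : 1 ≤ N) (hNn : N ≤ n) :
    (Integrable (gramPow h) (iidColumns (ballLaw β n) N) ↔
        Integrable (absDetPow (h + (β.val : ℂ) * (n - N))) (iidColumns (ballLaw β N) N)) ∧
      ∫ m, gramPow h m ∂iidColumns (ballLaw β n) N =
        areaRatio β N n N *
          (n * sphereArea (β.val * N) / (N * sphereArea (β.val * n))) ^ N *
          ∫ m, absDetPow (h + (β.val : ℂ) * (n - N)) m ∂iidColumns (ballLaw β N) N := by
  rw [absDetPow_eq_gramPow]
  refine integrable_iff_and_integral_eq (integrable_gramPow_ball_iff h hN hNn)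
    ((integrable_gramPow_ball_iff _ hN le_rfl).trans re_bound_square_iff) fun hh => ?_
  rw [integral_gramPow_ball hN hNn hh rfl,
    integral_gramPow_ball hN le_rfl (re_bound_square_iff.2 hh) (exponent_square h),
    mul_mul_mul_comm, areaRatio_mul_areaRatio, ← mul_pow]
  have h1 := sphereArea_nat_ne_zero (β := β) (k := N) hN
  have h2 : (N : ℂ) ≠ 0 := Nat.cast_ne_zero.2 (by omega)
  congr 2
  rw [div_mul_div_comm, ← mul_div_mul_left _ _ (mul_ne_zero h2 h1)]
  congr 1 <;> ring

theorem reduction_sphere (h : ℂ) (hN : 1 ≤ N) (hNn : N ≤ n) :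
    (Integrable (gramPow h) (iidColumns (sphereLaw β n) N) ↔
        Integrable (absDetPow (h + (β.val : ℂ) * (n - N))) (iidColumns (sphereLaw β N) N)) ∧
      ∫ m, gramPow h m ∂iidColumns (sphereLaw β n) N =
        areaRatio β N n N * (sphereArea (β.val * N) / sphereArea (β.val * n)) ^ N *
          ∫ m, absDetPow (h + (β.val : ℂ) * (n - N)) m ∂iidColumns (sphereLaw β N) N := by
  rw [absDetPow_eq_gramPow]
  have h1 := sphereArea_nat_ne_zero (β := β) (k := N) hN
  have h2 := sphereArea_nat_ne_zero (β := β) (k := n) (hN.trans hNn)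
  refine integrable_iff_and_integral_eq (integrable_gramPow_sphere_iff h hN hNn)
    ((integrable_gramPow_sphere_iff _ hN le_rfl).trans
      (or_congr_right re_bound_square_iff)) fun hh => ?_
  -- For `N = 1` the closed form may be unavailable, but both moments are 1 and the area factors
  -- cancel.
  rcases hh with rfl | hh
  · rw [integral_gramPow_sphere_one _ hNn, integral_gramPow_sphere_one _ le_rfl, areaRatio]
    simp only [Finset.Icc_self, Finset.prod_singleton, Nat.cast_one, sub_add_cancel, pow_one] at *
    rw [mul_one, div_mul_div_cancel₀ h1, div_self h2]
  · rw [integral_gramPow_sphere hN hNn hh rfl,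
      integral_gramPow_sphere hN le_rfl (re_bound_square_iff.2 hh) (exponent_square h),
      mul_mul_mul_comm, areaRatio_mul_areaRatio, ← mul_pow, mul_comm (_ / _),
      div_mul_div_cancel₀ h1]

theorem reduction_gauss (h : ℂ) (hN : 1 ≤ N) (hNn : N ≤ n) :
    (Integrable (gramPow h) (iidColumns (gaussLaw β n) N) ↔
        Integrable (absDetPow (h + (β.val : ℂ) * (n - N))) (iidColumns (gaussLaw β N) N)) ∧
      ∫ m, gramPow h m ∂iidColumns (gaussLaw β n) N =
        areaRatio β N n N * (1 / (Real.pi : ℂ)) ^ ((β.val : ℂ) * N * (n - N) / 2) *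
          ∫ m, absDetPow (h + (β.val : ℂ) * (n - N)) m ∂iidColumns (gaussLaw β N) N := by
  rw [absDetPow_eq_gramPow]
  refine integrable_iff_and_integral_eq (integrable_gramPow_gauss_iff h hN hNn)
    ((integrable_gramPow_gauss_iff _ hN le_rfl).trans re_bound_square_iff) fun hh => ?_
  rw [integral_gramPow_gauss hN hNn hh rfl,
    integral_gramPow_gauss hN le_rfl (re_bound_square_iff.2 hh) (exponent_square h),
    mul_mul_mul_comm, areaRatio_mul_areaRatio, one_div, Complex.inv_cpow, ← Complex.cpow_neg,
    ← Complex.cpow_add _ _ (Complex.ofReal_ne_zero.2 Real.pi_ne_zero)]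
  · congr 2
    ring
  -- Inverting the base is legitimate because the argument of `π` is 0, off the branch cut.
  · rw [Complex.arg_ofReal_of_nonneg Real.pi_pos.le]
    exact Real.pi_ne_zero.symm

end DetMoments

end

open DetMoments in
theorem corollaryC3p8 (β : DysonIndex) (n N : ℕ) (hN : 1 ≤ N) (hNn : N ≤ n) :
    -- the reduction to square matrices
    (∀ h : ℂ,
      ((Integrable (gramPow h) (iidColumns (ballLaw β n) N) ↔
          Integrable (absDetPow (h + (β.val : ℂ) * (n - N))) (iidColumns (ballLaw β N) N)) ∧
        ∫ m, gramPow h m ∂iidColumns (ballLaw β n) N =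
          areaRatio β N n N *
            (n * sphereArea (β.val * N) / (N * sphereArea (β.val * n))) ^ N *
            ∫ m, absDetPow (h + (β.val : ℂ) * (n - N)) m ∂iidColumns (ballLaw β N) N) ∧
      ((Integrable (gramPow h) (iidColumns (sphereLaw β n) N) ↔
          Integrable (absDetPow (h + (β.val : ℂ) * (n - N))) (iidColumns (sphereLaw β N) N)) ∧
        ∫ m, gramPow h m ∂iidColumns (sphereLaw β n) N =
          areaRatio β N n N *
            (sphereArea (β.val * N) / sphereArea (β.val * n)) ^ N *
            ∫ m, absDetPow (h + (β.val : ℂ) * (n - N)) m ∂iidColumns (sphereLaw β N) N) ∧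
      ((Integrable (gramPow h) (iidColumns (gaussLaw β n) N) ↔
          Integrable (absDetPow (h + (β.val : ℂ) * (n - N))) (iidColumns (gaussLaw β N) N)) ∧
        ∫ m, gramPow h m ∂iidColumns (gaussLaw β n) N =
          areaRatio β N n N *
            (1 / (Real.pi : ℂ)) ^ ((β.val : ℂ) * N * (n - N) / 2) *
            ∫ m, absDetPow (h + (β.val : ℂ) * (n - N)) m ∂iidColumns (gaussLaw β N) N)) ∧
    -- the moments in closed form, where `x = n + h / β`
    (∀ h x : ℂ, -((β.val : ℝ) * (n - N + 1)) < h.re → x = n + h / (β.val : ℂ) →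
      (Integrable (gramPow h) (iidColumns (ballLaw β n) N) ∧
        ∫ m, gramPow h m ∂iidColumns (ballLaw β n) N =
          areaRatio β N n x *
            (n * sphereArea (β.val * x) / (x * sphereArea (β.val * n))) ^ N) ∧
      (Integrable (gramPow h) (iidColumns (sphereLaw β n) N) ∧
        ∫ m, gramPow h m ∂iidColumns (sphereLaw β n) N =
          areaRatio β N n x *
            (sphereArea (β.val * x) / sphereArea (β.val * n)) ^ N) ∧
      (Integrable (gramPow h) (iidColumns (gaussLaw β n) N) ∧
        ∫ m, gramPow h m ∂iidColumns (gaussLaw β n) N =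
          areaRatio β N n x * (Real.pi : ℂ) ^ (N * h / 2))) := by
  refine ⟨fun h => ⟨reduction_ball h hN hNn, reduction_sphere h hN hNn, reduction_gauss h hN hNn⟩,
    fun h x hh hx => ⟨⟨(integrable_gramPow_ball_iff h hN hNn).2 hh,
      integral_gramPow_ball hN hNn hh hx⟩, ⟨(integrable_gramPow_sphere_iff h hN hNn).2 (Or.inr hh),
      integral_gramPow_sphere hN hNn hh hx⟩, ⟨(integrable_gramPow_gauss_iff h hN hNn).2 hh,
      integral_gramPow_gauss hN hNn hh hx⟩⟩⟩
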